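/- For $n\ge 1$ let $K^n=K^n((0,1))$ be the set of $C^n$ functions $f$ with compact support in $(0,1)$, extended by zero to $\mathbb{R}$, with $\|f\|_{K^n}=\|f\|_{C^n}+(\min\operatorname{supp} f)^{-1}$ (the last term being $0$ for $f=0$), and let $K^\infty=\bigcap_{n\ge1}K^n$. Write $f\in C([0,T),K^n)$ if $f(\cdot,t)\in K^n$ for all $t\in[0,T)$, $t\mapsto f(\cdot,t)$ is continuous in the $C^n$ norm, and $\|f(\cdot,t)\|_{K^n}$ is bounded on every $[0,s]$ with $s<T$. Consider the system on $(0,1)$ $$\partial_t\omega+u\,\partial_x\omega=\frac{\rho}{x},\qquad \partial_t\rho+u\,\partial_x\rho=0,\qquad u(x,t)=-x\int_x^1\frac{\omega(y,t)}{y}\,dy,$$ $$\omega(x,0)=\omega_0(x),\qquad \rho(x,0)=\rho_0(x).$$ **Theorem 3.** There exist non-negative $(\omega_0,\rho_0)\in K^\infty\times K^\infty$ and $T\in(0,\infty)$ such that the system has a solution $(\omega,\rho)$ on $[0,T)$ which belongs to $C([0,T),K^n)\times C([0,T),K^n)$ for every $n\ge1$, which is unique (every solution in $C([0,T'),K^1)\times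 C([0,T'),K^1)$ with the same data, for any $T'>0$, coincides with it on $[0,\min(T,T'))$), and which blows up at time $T$ in the sense that $$\int_0^T\|\omega(\cdot,t)\|_{L^\infty}\,dt=\infty,\qquad \int_0^T\|\partial_x\rho(\cdot,t)\|_{L^\infty}\,dt=\infty,\qquad \int_0^T\|\partial_xu(\cdot,t)\|_{L^\infty}\,dt=\infty,$$ the $L^\infty$ norms being taken over $(0,1)$. -/

import Mathlib

open Set Filter Topology MeasureTheory
open scoped ENNReal

namespace SingularBoussinesq

/-- The `C^n` norm of a function on the line: the sum of the sup norms of its derivatives of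
order at most `n`. -/
noncomputable def cNorm (n : ℕ) (f : ℝ → ℝ) : ℝ≥0∞ :=
  ∑ k ∈ Finset.range (n + 1), ⨆ x : ℝ, ‖iteratedDeriv k f x‖ₑ

/-- The size `‖f‖_{C^n} + (min supp f)⁻¹` (for functions supported in `(0,1)`);
the second term is `0` for `f = 0`. -/
noncomputable def kNorm (n : ℕ) (f : ℝ → ℝ) : ℝ≥0∞ :=
  cNorm n f + (⨅ x ∈ tsupport f, ENNReal.ofReal x)⁻¹

/-- The space `K^n((0,1))`: functions of class `C^n` with compact support in `(0,1)`, extended by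
zero to the line. -/
def MemK (n : ℕ) (f : ℝ → ℝ) : Prop :=
  ContDiff ℝ n f ∧ HasCompactSupport f ∧ tsupport f ⊆ Ioo 0 1

/-- The space `K^∞((0,1))`, the intersection of all `K^n((0,1))` with `n ≥ 1`. -/
def MemKInfty (f : ℝ → ℝ) : Prop := ∀ n : ℕ, 1 ≤ n → MemK n f

/-- The class `C([0,T), K^n)`: the values lie in `K^n`, the dependence on time is continuous in the
`C^n` norm, and the `K^n` size is bounded on compact subintervals of `[0,T)`, so that the supports
stay away from the origin there. (The `K^n` size itself is not homogeneous and does not tend to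
zero for differences.) -/
def ContinuousInK (n : ℕ) (T : ℝ) (f : ℝ → ℝ → ℝ) : Prop :=
  (∀ t ∈ Ico 0 T, MemK n (f t)) ∧
  (∀ s ∈ Ico 0 T, Tendsto (fun t => cNorm n (f t - f s)) (𝓝[Ico 0 T] s) (𝓝 0)) ∧
  (∀ s ∈ Ico 0 T, ∃ M : ℝ≥0∞, M ≠ ∞ ∧ ∀ t ∈ Icc 0 s, kNorm n (f t) ≤ M)

/-- The velocity `u(x) = -x ∫_x^1 ω(y)/y dy`. -/
noncomputable def velocity (ω : ℝ → ℝ) (x : ℝ) : ℝ :=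
  -x * ∫ y in x..1, ω y / y

/-- `(ω, ρ)`, with `ω t x` for `ω(x,t)`, is a solution in `C([0,T), K^n) × C([0,T), K^n)` of
`∂ₜω + u ∂ₓω = ρ/x`, `∂ₜρ + u ∂ₓρ = 0`, `u = -x ∫_x^1 ω(y,t)/y dy` on `(0,1) × [0,T)` with data
`(ω₀, ρ₀)`. Time derivatives are one-sided at `t = 0`. -/
structure IsSolution (n : ℕ) (ω₀ ρ₀ : ℝ → ℝ) (T : ℝ) (ω ρ : ℝ → ℝ → ℝ) : Prop where
  omega_mem : ContinuousInK n T ω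
  rho_mem : ContinuousInK n T ρ
  omega_init : ω 0 = ω₀
  rho_init : ρ 0 = ρ₀
  omega_eq : ∀ t ∈ Ico 0 T, ∀ x ∈ Ioo (0 : ℝ) 1,
    HasDerivWithinAt (fun s => ω s x)
      (ρ t x / x - velocity (ω t) x * deriv (ω t) x) (Ico 0 T) t
  rho_eq : ∀ t ∈ Ico 0 T, ∀ x ∈ Ioo (0 : ℝ) 1,
    HasDerivWithinAt (fun s => ρ s x)
      (-(velocity (ω t) x * deriv (ρ t) x)) (Ico 0 T) t

/-- The `L^∞((0,1))` norm. -/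
noncomputable def supNorm (f : ℝ → ℝ) : ℝ≥0∞ :=
  eLpNorm f ∞ (volume.restrict (Ioo (0 : ℝ) 1))

end SingularBoussinesq

/-! In the variable `z = -log x` the particle speed is the integral of the vorticity from `0` to
`z`, and `1/x` becomes `exp z`. Let `Z t a` be the position of the particle with label `a`, `v` the
vorticity along its path and `r a` its density, which is transported. Then `∂ₜ v = r exp Z` and `∂ₜ
∂ₐ Z = v ∂ₐ Z`. Starting from zero vorticity, these integrate to the closed equation `Z = nextFlow r
Z`, which loses no derivative.

Existence: for `r ≥ 0` the map `nextFlow` is monotone, so the Picard iterates started from the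
identity increase, and they converge as long as they stay bounded at `A`, the right end of the
support of `r` (`IsDensity.isFlow_limitFlow`). A bound at one time persists a little longer
(`IsDensity.exists_extension`), so at a finite maximal time `T` the flow at `A` is unbounded
(`IsDensity.exists_lifetime`).

Finite lifetime: let `r = 4` on `[1, 6]` and follow the moving label `a = 1 + s` at time `s`. With
`G = Z`, `p = log ∂ₐ Z` and `q = v` there, `G' ≥ exp p`, `p' ≥ q` and `q' ≥ 4 exp G`. This cyclic
system forces `G + p + log q` to infinity before time `5` (`IsFlow.lifetime_le`).

Blow-up of the norms: unboundedness of `Z t A` makes `log ∂ₐ Z`, the time integral of `v` along a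
path, unbounded, hence also `v`, the time integral of `ρ/x` along a path. The first bounds the
integral of the sup norm of `ω` from below, the second that of `∂ₓρ` since `ρ` vanishes at `0`, and
`∂ₓu` is compared with `v / 2`.

The Eulerian solution comes from inverting `Z t`; uniqueness in `K^1` is an `L²` energy estimate
(`integral_energyRate_le`, `IsSolution.unique`). -/

namespace SingularBoussinesq

/-! ### Smoothness of integrals depending on a parameter. -/

section ParametricPrimitives

variable {F F₁ G G₁ G₂ : ℝ × ℝ → ℝ}

theorem hasFDerivAt_of_partials
    (h₁ : ∀ p : ℝ × ℝ, HasDerivAt (fun t => G (t, p.2)) (G₁ p) p.1)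
    (h₂ : ∀ p : ℝ × ℝ, HasDerivAt (fun a => G (p.1, a)) (G₂ p) p.2)
    (c₁ : Continuous G₁) (c₂ : Continuous G₂) (p : ℝ × ℝ) :
    HasFDerivAt G (G₁ p • ContinuousLinearMap.fst ℝ ℝ ℝ + G₂ p • ContinuousLinearMap.snd ℝ ℝ ℝ)
      p := by
  have key := hasStrictFDerivAt_uncurry_coprod (𝕜 := ℝ) (u := p) (f := fun t a => G (t, a))
    (f₁ := fun t a => ContinuousLinearMap.toSpanSingleton ℝ (G₁ (t, a)))
    (f₂ := fun t a => ContinuousLinearMap.toSpanSingleton ℝ (G₂ (t, a)))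
    (Eventually.of_forall fun v => (h₁ v).hasFDerivAt)
    (Eventually.of_forall fun v => (h₂ v).hasFDerivAt)
    (by
      refine Continuous.continuousAt ?_
      exact (ContinuousLinearMap.toSpanSingletonCLE (𝕜 := ℝ) (E := ℝ)).continuous.comp c₁)
    (by
      refine Continuous.continuousAt ?_
      exact (ContinuousLinearMap.toSpanSingletonCLE (𝕜 := ℝ) (E := ℝ)).continuous.comp c₂)
  convert! key.hasFDerivAt using 1
  ext <;> simp [Function.HasUncurry.uncurry]

/-- This is the step that gains one derivative in the bootstrap for the flow, whose two partials are
explicit integrals. -/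
theorem contDiff_succ_of_partials {n : ℕ}
    (h₁ : ∀ p : ℝ × ℝ, HasDerivAt (fun t => G (t, p.2)) (G₁ p) p.1)
    (h₂ : ∀ p : ℝ × ℝ, HasDerivAt (fun a => G (p.1, a)) (G₂ p) p.2)
    (c₁ : ContDiff ℝ n G₁) (c₂ : ContDiff ℝ n G₂) : ContDiff ℝ (n + 1 : ℕ) G := by
  push_cast
  rw [contDiff_succ_iff_hasFDerivAt]
  refine ⟨fun p => G₁ p • ContinuousLinearMap.fst ℝ ℝ ℝ + G₂ p • ContinuousLinearMap.snd ℝ ℝ ℝ,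
    by fun_prop, hasFDerivAt_of_partials h₁ h₂ c₁.continuous c₂.continuous⟩

theorem hasDerivAt_parametric_integral (hF : Continuous F) (hF₁ : Continuous F₁)
    (h : ∀ p : ℝ × ℝ, HasDerivAt (fun t => F (t, p.2)) (F₁ p) p.1) (a t : ℝ) :
    HasDerivAt (fun t => ∫ b in (0 : ℝ)..a, F (t, b)) (∫ b in (0 : ℝ)..a, F₁ (t, b)) t := by
  have hK : IsCompact (Icc (t - 1) (t + 1) ×ˢ uIcc 0 a) := isCompact_Icc.prod isCompact_uIcc
  obtain ⟨C, hC⟩ := hK.exists_bound_of_continuousOn hF₁.continuousOn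
  refine (intervalIntegral.hasDerivAt_integral_of_dominated_loc_of_deriv_le
    (F := fun t b => F (t, b)) (F' := fun t b => F₁ (t, b)) (bound := fun _ => C)
    (Icc_mem_nhds (by linarith : t - 1 < t) (by linarith : t < t + 1)) ?_ ?_ ?_ ?_ ?_ ?_).2
  · exact Eventually.of_forall fun s => Continuous.aestronglyMeasurable (by fun_prop)
  · exact Continuous.intervalIntegrable (by fun_prop) _ _
  · exact Continuous.aestronglyMeasurable (by fun_prop)
  · exact ae_of_all _ fun b hb s hs => hC (s, b) ⟨hs, uIoc_subset_uIcc hb⟩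
  · exact intervalIntegrable_const
  · exact ae_of_all _ fun b _ s _ => h (s, b)

theorem hasDerivAt_primitive_snd (hF : Continuous F) (p : ℝ × ℝ) :
    HasDerivAt (fun a => ∫ b in (0 : ℝ)..a, F (p.1, b)) (F p) p.2 :=
  intervalIntegral.integral_hasDerivAt_right (Continuous.intervalIntegrable (by fun_prop) _ _)
    (Continuous.stronglyMeasurableAtFilter (by fun_prop) _ _)
    (Continuous.continuousAt (by fun_prop))

theorem continuous_primitive_snd (hF : Continuous F) :
    Continuous fun p : ℝ × ℝ => ∫ b in (0 : ℝ)..p.2, F (p.1, b) :=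
  intervalIntegral.continuous_parametric_primitive_of_continuous (f := fun t b => F (t, b)) hF

theorem hasDerivAt_fst_of_contDiff {n : ℕ} (hF : ContDiff ℝ (n + 1 : ℕ) F) (p : ℝ × ℝ) :
    HasDerivAt (fun t => F (t, p.2)) (fderiv ℝ F p (1, 0)) p.1 := by
  have h : HasFDerivAt F (fderiv ℝ F p) (p.1, p.2) :=
    (hF.differentiable (by simp) p).hasFDerivAt
  have hg : HasDerivAt (fun t : ℝ => (t, p.2)) ((1 : ℝ), (0 : ℝ)) p.1 :=
    HasDerivAt.prodMk (hasDerivAt_id p.1) (hasDerivAt_const p.1 p.2)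
  exact HasFDerivAt.comp_hasDerivAt p.1 h hg

/-- Induction on `n`: the partial in the upper limit is `F` itself, and the partial in the parameter
is the primitive of `∂ₜ F`, which is one class lower. -/
theorem contDiff_primitive_snd {n : ℕ} (hF : ContDiff ℝ n F) :
    ContDiff ℝ n fun p : ℝ × ℝ => ∫ b in (0 : ℝ)..p.2, F (p.1, b) := by
  induction n generalizing F with
  | zero =>
    have := continuous_primitive_snd hF.continuous
    simpa using! (contDiff_zero (𝕜 := ℝ)).2 this
  | succ n ih =>
    have hF₁ : ContDiff ℝ n fun p => fderiv ℝ F p (1, 0) :=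
      (hF.fderiv_right (m := n) (by simp)).clm_apply contDiff_const
    refine contDiff_succ_of_partials (G₁ := fun p => ∫ b in (0 : ℝ)..p.2, fderiv ℝ F (p.1, b) (1, 0))
      (G₂ := F) (fun p => ?_) (hasDerivAt_primitive_snd hF.continuous) (ih hF₁)
      (hF.of_le (by exact_mod_cast Nat.le_succ n))
    exact hasDerivAt_parametric_integral hF.continuous hF₁.continuous
      (hasDerivAt_fst_of_contDiff hF) p.2 p.1

theorem contDiff_primitive_fst {n : ℕ} (hF : ContDiff ℝ n F) :
    ContDiff ℝ n fun p : ℝ × ℝ => ∫ s in (0 : ℝ)..p.1, F (s, p.2) :=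
  (contDiff_primitive_snd (F := fun p => F (p.2, p.1)) (by fun_prop)).comp
    (contDiff_snd.prodMk contDiff_fst)

theorem hasDerivAt_primitive_fst (hF : Continuous F) (p : ℝ × ℝ) :
    HasDerivAt (fun t => ∫ s in (0 : ℝ)..t, F (s, p.2)) (F p) p.1 :=
  hasDerivAt_primitive_snd (F := fun p => F (p.2, p.1)) (by fun_prop) (p.2, p.1)

end ParametricPrimitives

/-! ### The Lagrangian equations and their Picard iterates. -/

/-- The vorticity along the trajectory with label `a`, for the flow `Z` in the variable
`z = -log x`. -/
noncomputable def labelVorticity (r : ℝ → ℝ) (Z : ℝ → ℝ → ℝ) (t a : ℝ) : ℝ :=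
  r a * ∫ s in (0 : ℝ)..t, Real.exp (Z s a)

/-- The logarithm of the label derivative of the flow. -/
noncomputable def logStretch (r : ℝ → ℝ) (Z : ℝ → ℝ → ℝ) (t a : ℝ) : ℝ :=
  ∫ s in (0 : ℝ)..t, labelVorticity r Z s a

/-- The flow recovered from the vorticity that `Z` generates. -/
noncomputable def nextFlow (r : ℝ → ℝ) (Z : ℝ → ℝ → ℝ) (t a : ℝ) : ℝ :=
  ∫ b in (0 : ℝ)..a, Real.exp (logStretch r Z t b)

/-- The Picard iterates of the flow, starting from the identity. -/
noncomputable def flowIter (r : ℝ → ℝ) : ℕ → ℝ → ℝ → ℝ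
  | 0 => fun _ a => a
  | k + 1 => nextFlow r (flowIter r k)

section

variable {r : ℝ → ℝ} {Z Z' : ℝ → ℝ → ℝ}

theorem continuous_labelVorticity (hr : Continuous r) (hZ : Continuous (Function.uncurry Z)) :
    Continuous (Function.uncurry (labelVorticity r Z)) := by
  have h := continuous_primitive_snd (F := fun p : ℝ × ℝ => Real.exp (Z p.2 p.1))
    (Real.continuous_exp.comp (hZ.comp continuous_swap))
  exact (hr.comp continuous_snd).mul (h.comp continuous_swap)

theorem continuous_logStretch (hr : Continuous r) (hZ : Continuous (Function.uncurry Z)) :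
    Continuous (Function.uncurry (logStretch r Z)) := by
  have h := continuous_primitive_snd (F := fun p : ℝ × ℝ => labelVorticity r Z p.2 p.1)
    ((continuous_labelVorticity hr hZ).comp continuous_swap)
  exact h.comp continuous_swap

theorem continuous_nextFlow (hr : Continuous r) (hZ : Continuous (Function.uncurry Z)) :
    Continuous (Function.uncurry (nextFlow r Z)) :=
  continuous_primitive_snd (F := fun p : ℝ × ℝ => Real.exp (logStretch r Z p.1 p.2))
    (Real.continuous_exp.comp (continuous_logStretch hr hZ))

theorem continuous_flowIter (hr : Continuous r) (k : ℕ) :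
    Continuous (Function.uncurry (flowIter r k)) := by
  induction k with
  | zero => exact continuous_snd
  | succ k ih => exact continuous_nextFlow hr ih

theorem logStretch_of_eq_zero {a : ℝ} (h : r a = 0) (t : ℝ) : logStretch r Z t a = 0 := by
  simp [logStretch, labelVorticity, h]

theorem labelVorticity_nonneg (hr : ∀ a, 0 ≤ r a) {t : ℝ} (ht : 0 ≤ t) (a : ℝ) :
    0 ≤ labelVorticity r Z t a :=
  mul_nonneg (hr a) (intervalIntegral.integral_nonneg ht fun _ _ => (Real.exp_pos _).le)

theorem logStretch_nonneg (hr : ∀ a, 0 ≤ r a) {t : ℝ} (ht : 0 ≤ t) (a : ℝ) :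
    0 ≤ logStretch r Z t a :=
  intervalIntegral.integral_nonneg ht fun _ hs => labelVorticity_nonneg hr hs.1 a

/-! ### Bounds in terms of the vorticity. -/

section bounds

theorem abs_intervalIntegral_le {f : ℝ → ℝ} {a b C : ℝ} (h : ∀ x ∈ uIoc a b, |f x| ≤ C) :
    |∫ x in a..b, f x| ≤ C * |b - a| := by
  simp only [← Real.norm_eq_abs (f _)] at h
  simpa only [Real.norm_eq_abs (∫ x in a..b, f x)] using
    intervalIntegral.norm_integral_le_of_norm_le_const h

variable {R τ N V : ℝ}

/-- Labels without density carry no vorticity, so `Z` has to be bounded only where `r b ≠ 0`. This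
is what lets a bound at the single label `A` control everything. -/
theorem abs_labelVorticity_le (hr : ∀ a, 0 ≤ r a) (hR : ∀ a, r a ≤ R)
    (hb : ∀ s, |s| ≤ τ → ∀ b, r b ≠ 0 → Z s b ≤ N) (hV : R * (τ * Real.exp N) ≤ V) {t : ℝ}
    (ht : |t| ≤ τ) (a : ℝ) : |labelVorticity r Z t a| ≤ V := by
  have hR0 : 0 ≤ R := (hr 0).trans (hR 0)
  have hτ : 0 ≤ τ := (abs_nonneg t).trans ht
  refine le_trans ?_ hV
  by_cases ha : r a = 0
  · simp only [labelVorticity, ha, zero_mul, abs_zero]; positivity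
  rw [labelVorticity, abs_mul, abs_of_nonneg (hr a)]
  have h : |∫ s in (0 : ℝ)..t, Real.exp (Z s a)| ≤ Real.exp N * |t - 0| := by
    refine abs_intervalIntegral_le fun s hs => ?_
    rw [abs_of_nonneg (Real.exp_pos _).le]
    refine Real.exp_le_exp.2 (hb s ?_ a ha)
    have := abs_sub_left_of_mem_uIcc (uIoc_subset_uIcc hs)
    simp only [sub_zero] at this
    exact this.trans ht
  rw [sub_zero] at h
  refine mul_le_mul (hR a) (h.trans ?_) (abs_nonneg _) hR0
  rw [mul_comm]
  gcongr

theorem abs_logStretch_sub_le (hrc : Continuous r) (hZ : Continuous (Function.uncurry Z))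
    (hv : ∀ s, |s| ≤ τ → ∀ b, |labelVorticity r Z s b| ≤ V) {t t' : ℝ}
    (ht : |t| ≤ τ) (ht' : |t'| ≤ τ) (a : ℝ) :
    |logStretch r Z t a - logStretch r Z t' a| ≤ V * |t - t'| := by
  have hc : Continuous fun s => labelVorticity r Z s a :=
    (continuous_labelVorticity hrc hZ).comp (by fun_prop : Continuous fun s : ℝ => (s, a))
  rw [logStretch, logStretch, intervalIntegral.integral_interval_sub_left
    (hc.intervalIntegrable _ _) (hc.intervalIntegrable _ _)]
  refine abs_intervalIntegral_le fun s hs => hv s ?_ a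
  have hs' := uIoc_subset_uIcc hs
  rw [mem_uIcc] at hs'
  rw [abs_le] at *
  rcases hs' with h | h <;> constructor <;> linarith [h.1, h.2]

theorem abs_logStretch_le (hrc : Continuous r) (hZ : Continuous (Function.uncurry Z))
    (hv : ∀ s, |s| ≤ τ → ∀ b, |labelVorticity r Z s b| ≤ V) {t : ℝ}
    (ht : |t| ≤ τ) (a : ℝ) : |logStretch r Z t a| ≤ V * τ := by
  have h0 : |(0 : ℝ)| ≤ τ := by simpa using (abs_nonneg t).trans ht
  have hV : 0 ≤ V := (abs_nonneg _).trans (hv 0 h0 0)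
  have h := abs_logStretch_sub_le hrc hZ hv ht h0 a
  have e : logStretch r Z 0 a = 0 := by simp [logStretch]
  rw [e, sub_zero, sub_zero] at h
  exact h.trans (by gcongr)

theorem abs_exp_sub_exp_le {x y P : ℝ} (hx : x ≤ P) (hy : y ≤ P) :
    |Real.exp x - Real.exp y| ≤ Real.exp P * |x - y| := by
  have := Convex.norm_image_sub_le_of_norm_deriv_le (f := Real.exp) (s := Iic P)
    (C := Real.exp P) (x := y) (y := x) (fun z _ => Real.differentiableAt_exp)
    (fun z hz => by simpa using hz) (convex_Iic P) hy hx
  exact this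

theorem abs_nextFlow_sub_time_le (hrc : Continuous r) (hZ : Continuous (Function.uncurry Z))
    (hv : ∀ s, |s| ≤ τ → ∀ b, |labelVorticity r Z s b| ≤ V) {t t' : ℝ}
    (ht : |t| ≤ τ) (ht' : |t'| ≤ τ) (a : ℝ) :
    |nextFlow r Z t a - nextFlow r Z t' a| ≤ Real.exp (V * τ) * (V * |t - t'|) * |a| := by
  have hc : ∀ t, Continuous fun b => Real.exp (logStretch r Z t b) := fun t =>
    Real.continuous_exp.comp
      ((continuous_logStretch hrc hZ).comp (by fun_prop : Continuous fun b : ℝ => (t, b)))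
  rw [nextFlow, nextFlow, ← intervalIntegral.integral_sub ((hc t).intervalIntegrable _ _)
    ((hc t').intervalIntegrable _ _)]
  have h := abs_intervalIntegral_le (a := 0) (b := a)
    (C := Real.exp (V * τ) * (V * |t - t'|))
    (f := fun b => Real.exp (logStretch r Z t b) - Real.exp (logStretch r Z t' b))
    fun b _ => ?_
  · simpa using h
  refine (abs_exp_sub_exp_le (le_of_abs_le (abs_logStretch_le hrc hZ hv ht b))
    (le_of_abs_le (abs_logStretch_le hrc hZ hv ht' b))).trans ?_
  gcongr
  exact abs_logStretch_sub_le hrc hZ hv ht ht' b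

theorem abs_nextFlow_sub_label_le (hrc : Continuous r) (hZ : Continuous (Function.uncurry Z))
    (hv : ∀ s, |s| ≤ τ → ∀ b, |labelVorticity r Z s b| ≤ V) {t : ℝ}
    (ht : |t| ≤ τ) (a a' : ℝ) :
    |nextFlow r Z t a - nextFlow r Z t a'| ≤ Real.exp (V * τ) * |a - a'| := by
  have hc : Continuous fun b => Real.exp (logStretch r Z t b) :=
    Real.continuous_exp.comp
      ((continuous_logStretch hrc hZ).comp (by fun_prop : Continuous fun b : ℝ => (t, b)))
  rw [nextFlow, nextFlow, intervalIntegral.integral_interval_sub_left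
    (hc.intervalIntegrable _ _) (hc.intervalIntegrable _ _)]
  refine abs_intervalIntegral_le fun b _ => ?_
  rw [abs_of_nonneg (Real.exp_pos _).le]
  exact Real.exp_le_exp.2 (le_of_abs_le (abs_logStretch_le hrc hZ hv ht b))

end bounds

/-! ### Symmetry in time and monotonicity. -/

section monotone

/-- An even flow generates an odd vorticity, hence an even stretch and again an even flow. The flow
is taken on `(-T, T)` so that time `0` is interior; evenness carries estimates from `t ≥ 0` to all
times. -/
theorem labelVorticity_neg (h : ∀ t a, Z (-t) a = Z t a) (t a : ℝ) :
    labelVorticity r Z (-t) a = -labelVorticity r Z t a := by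
  have := intervalIntegral.integral_comp_neg (a := 0) (b := t) fun s => Real.exp (Z s a)
  simp only [h, neg_zero] at this
  rw [labelVorticity, labelVorticity, intervalIntegral.integral_symm, ← this, mul_neg]

theorem logStretch_neg (h : ∀ t a, Z (-t) a = Z t a) (t a : ℝ) :
    logStretch r Z (-t) a = logStretch r Z t a := by
  have := intervalIntegral.integral_comp_neg (a := 0) (b := t) fun s => labelVorticity r Z s a
  simp only [labelVorticity_neg h, neg_zero, intervalIntegral.integral_neg] at this
  rw [logStretch, intervalIntegral.integral_symm, ← this, neg_neg, logStretch]

theorem nextFlow_neg (h : ∀ t a, Z (-t) a = Z t a) (t a : ℝ) :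
    nextFlow r Z (-t) a = nextFlow r Z t a := by
  simp only [nextFlow, logStretch_neg h]

theorem flowIter_neg (k : ℕ) (t a : ℝ) : flowIter r k (-t) a = flowIter r k t a := by
  induction k generalizing t a with
  | zero => rfl
  | succ k ih => exact nextFlow_neg ih t a

theorem flowIter_abs (k : ℕ) (t a : ℝ) : flowIter r k |t| a = flowIter r k t a := by
  rcases abs_choice t with h | h <;> rw [h]
  exact flowIter_neg k t a

theorem flowIter_mono_label (hr : Continuous r) (k : ℕ) (t : ℝ) : Monotone (flowIter r k t) := by
  cases k with
  | zero => exact monotone_id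
  | succ k =>
    intro a a' h
    have hc : Continuous fun b => Real.exp (logStretch r (flowIter r k) t b) :=
      Real.continuous_exp.comp ((continuous_logStretch hr (continuous_flowIter hr k)).comp
        (by fun_prop : Continuous fun b : ℝ => (t, b)))
    rw [← sub_nonneg]
    simp only [flowIter, nextFlow]
    rw [intervalIntegral.integral_interval_sub_left
      (hc.intervalIntegrable _ _) (hc.intervalIntegrable _ _)]
    exact intervalIntegral.integral_nonneg h fun _ _ => (Real.exp_pos _).le

theorem logStretch_mono_time (hrc : Continuous r) (hr : ∀ a, 0 ≤ r a)
    (hZ : Continuous (Function.uncurry Z)) {t t' : ℝ} (ht : 0 ≤ t) (h : t ≤ t') (a : ℝ) :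
    logStretch r Z t a ≤ logStretch r Z t' a := by
  have hc : Continuous fun s => labelVorticity r Z s a :=
    (continuous_labelVorticity hrc hZ).comp (by fun_prop : Continuous fun s : ℝ => (s, a))
  rw [← sub_nonneg, logStretch, logStretch, intervalIntegral.integral_interval_sub_left
    (hc.intervalIntegrable _ _) (hc.intervalIntegrable _ _)]
  exact intervalIntegral.integral_nonneg h fun s hs => labelVorticity_nonneg hr (ht.trans hs.1) a

theorem flowIter_mono_time (hrc : Continuous r) (hr : ∀ a, 0 ≤ r a) (k : ℕ) {t t' : ℝ}
    (ht : |t| ≤ |t'|) {a : ℝ} (ha : 0 ≤ a) : flowIter r k t a ≤ flowIter r k t' a := by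
  rw [← flowIter_abs k t, ← flowIter_abs k t']
  cases k with
  | zero => exact le_rfl
  | succ k =>
    have hZ := continuous_flowIter hrc k
    have hc : ∀ t, Continuous fun b => Real.exp (logStretch r (flowIter r k) t b) := fun t =>
      Real.continuous_exp.comp
        ((continuous_logStretch hrc hZ).comp (by fun_prop : Continuous fun b : ℝ => (t, b)))
    exact intervalIntegral.integral_mono_on ha ((hc _).intervalIntegrable _ _)
      ((hc _).intervalIntegrable _ _) fun b _ =>
        Real.exp_le_exp.2 (logStretch_mono_time hrc hr hZ (abs_nonneg t) ht b)

/-- Each of the three nested integrations and exponentials is increasing because `r ≥ 0`. -/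
theorem nextFlow_mono (hrc : Continuous r) (hr : ∀ a, 0 ≤ r a)
    (hZ : Continuous (Function.uncurry Z)) (hZ' : Continuous (Function.uncurry Z'))
    (h : ∀ t a, 0 ≤ t → 0 ≤ a → Z t a ≤ Z' t a) {t a : ℝ} (ht : 0 ≤ t) (ha : 0 ≤ a) :
    nextFlow r Z t a ≤ nextFlow r Z' t a := by
  have cs : ∀ {Z}, Continuous (Function.uncurry Z) → ∀ t, Continuous fun b =>
      Real.exp (logStretch r Z t b) := fun hZ t => Real.continuous_exp.comp
    ((continuous_logStretch hrc hZ).comp (by fun_prop : Continuous fun b : ℝ => (t, b)))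
  have cv : ∀ {Z}, Continuous (Function.uncurry Z) → ∀ a, Continuous fun s =>
      labelVorticity r Z s a := fun hZ a =>
    (continuous_labelVorticity hrc hZ).comp (by fun_prop : Continuous fun s : ℝ => (s, a))
  have ce : ∀ {Z : ℝ → ℝ → ℝ}, Continuous (Function.uncurry Z) → ∀ a, Continuous fun s =>
      Real.exp (Z s a) := fun hZ a => Real.continuous_exp.comp
    (hZ.comp (by fun_prop : Continuous fun s : ℝ => (s, a)))
  refine intervalIntegral.integral_mono_on ha ((cs hZ t).intervalIntegrable _ _)
    ((cs hZ' t).intervalIntegrable _ _) fun b hb => Real.exp_le_exp.2 ?_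
  refine intervalIntegral.integral_mono_on ht ((cv hZ b).intervalIntegrable _ _)
    ((cv hZ' b).intervalIntegrable _ _) fun s hs => ?_
  refine mul_le_mul_of_nonneg_left ?_ (hr b)
  exact intervalIntegral.integral_mono_on hs.1 ((ce hZ b).intervalIntegrable _ _)
    ((ce hZ' b).intervalIntegrable _ _) fun s' hs' => Real.exp_le_exp.2 (h s' b hs'.1 hb.1)

theorem flowIter_le_succ (hrc : Continuous r) (hr : ∀ a, 0 ≤ r a) (k : ℕ) (t : ℝ) {a : ℝ}
    (ha : 0 ≤ a) : flowIter r k t a ≤ flowIter r (k + 1) t a := by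
  rw [← flowIter_abs k t, ← flowIter_abs (k + 1) t]
  suffices h : ∀ t a, 0 ≤ t → 0 ≤ a → flowIter r k t a ≤ flowIter r (k + 1) t a from
    h _ _ (abs_nonneg t) ha
  clear ha a t
  induction k with
  | zero =>
    intro t a ht ha
    have hc : Continuous fun b => Real.exp (logStretch r (flowIter r 0) t b) :=
      Real.continuous_exp.comp ((continuous_logStretch hrc (continuous_flowIter hrc 0)).comp
        (by fun_prop : Continuous fun b : ℝ => (t, b)))
    have := intervalIntegral.integral_mono_on (μ := volume) ha (intervalIntegrable_const (c := (1 : ℝ)))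
      (hc.intervalIntegrable _ _) fun b _ => Real.one_le_exp (logStretch_nonneg hr ht b)
    simpa using! this
  | succ k ih =>
    intro t a ht ha
    exact nextFlow_mono hrc hr (continuous_flowIter hrc k) (continuous_flowIter hrc (k + 1)) ih
      ht ha

theorem flowIter_of_nonpos (hr0 : ∀ a ≤ 0, r a = 0) (k : ℕ) (t : ℝ) {a : ℝ} (ha : a ≤ 0) :
    flowIter r k t a = a := by
  cases k with
  | zero => rfl
  | succ k =>
    have : ∫ b in (0 : ℝ)..a, Real.exp (logStretch r (flowIter r k) t b)
        = ∫ b in (0 : ℝ)..a, (1 : ℝ) := by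
      refine intervalIntegral.integral_congr fun b hb => ?_
      rw [uIcc_of_ge ha] at hb
      simp [logStretch_of_eq_zero (hr0 b hb.2)]
    simpa [flowIter, nextFlow] using this

theorem flowIter_monotone (hrc : Continuous r) (hr : ∀ a, 0 ≤ r a) (hr0 : ∀ a ≤ 0, r a = 0)
    (t a : ℝ) : Monotone fun k => flowIter r k t a := by
  refine monotone_nat_of_le_succ fun k => ?_
  rcases le_total 0 a with ha | ha
  · exact flowIter_le_succ hrc hr k t ha
  · rw [flowIter_of_nonpos hr0 k t ha, flowIter_of_nonpos hr0 (k + 1) t ha]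

end monotone

end

/-! ### Lifetime and convergence of the iterates. -/

/-- The data of a flow in `z = -log x` coordinates started from rest: `r` is the density as a
function of the label, bounded by `R` and supported in `[1/2, A]`. -/
structure IsDensity (r : ℝ → ℝ) (R A : ℝ) : Prop where
  smooth : ContDiff ℝ ((⊤ : ℕ∞) : WithTop ℕ∞) r
  nonneg : ∀ a, 0 ≤ r a
  le : ∀ a, r a ≤ R
  left : ∀ a ≤ 1 / 2, r a = 0
  right : ∀ a, A ≤ a → r a = 0
  pos : 0 < A

/-- A solution of the Lagrangian equations on the time interval `(-T, T)`. -/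
structure IsFlow (r : ℝ → ℝ) (T : ℝ) (Z : ℝ → ℝ → ℝ) : Prop where
  continuousOn : ContinuousOn (Function.uncurry Z) (Ioo (-T) T ×ˢ univ)
  eq : ∀ t ∈ Ioo (-T) T, ∀ a, Z t a = nextFlow r Z t a

namespace IsDensity

variable {r : ℝ → ℝ} {R A : ℝ}

theorem bound_nonneg (h : IsDensity r R A) : 0 ≤ R := (h.nonneg 0).trans (h.le 0)

theorem left_nonpos (h : IsDensity r R A) (a : ℝ) (ha : a ≤ 0) : r a = 0 :=
  h.left a (by linarith)

theorem mem_of_ne_zero (h : IsDensity r R A) {b : ℝ} (hb : r b ≠ 0) : b ∈ Icc (1 / 2) A := by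
  refine ⟨?_, ?_⟩
  · by_contra hc; exact hb (h.left b (not_le.1 hc).le)
  · by_contra hc; exact hb (h.right b (not_le.1 hc).le)

/-- The iterates increase in `|t|` and in the label, so the value at `(τ, A)` dominates all earlier
values on the support of the density. -/
theorem flowIter_le (h : IsDensity r R A) {k : ℕ} {s τ N b : ℝ}
    (hN : flowIter r k τ A ≤ N) (hs : |s| ≤ |τ|) (hb : r b ≠ 0) : flowIter r k s b ≤ N :=
  ((flowIter_mono_time h.smooth.continuous h.nonneg k hs
    (one_half_pos.le.trans (h.mem_of_ne_zero hb).1)).trans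
    (flowIter_mono_label h.smooth.continuous k τ (h.mem_of_ne_zero hb).2)).trans hN

/-- The point is that `ε` does not depend on `k`. If iterate `k` is at most `M + 1` at `(τ + ε, A)`,
its vorticity is at most `V`, so iterate `k + 1` moves by at most `C * ε ≤ 1` after time `τ`, where
it was at most `M`. -/
theorem exists_extension (h : IsDensity r R A) {τ M : ℝ} (hτ : 0 ≤ τ)
    (hM : ∀ k, flowIter r k τ A ≤ M) :
    ∃ ε > 0, ∀ k, flowIter r k (τ + ε) A ≤ M + 1 := by
  have hR := h.bound_nonneg
  have hA := h.pos
  set V := R * ((τ + 1) * Real.exp (M + 1)) with hV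
  have hV0 : 0 ≤ V := by positivity
  set C := Real.exp (V * (τ + 1)) * V * A with hC
  have hC0 : 0 ≤ C := by positivity
  refine ⟨min 1 (1 / (C + 1)), by positivity, fun k => ?_⟩
  set ε := min 1 (1 / (C + 1)) with hε
  have hε0 : 0 < ε := by positivity
  have hε1 : ε ≤ 1 := min_le_left _ _
  have hCε : C * ε ≤ 1 := by
    have : ε ≤ 1 / (C + 1) := min_le_right _ _
    rw [le_div_iff₀ (by positivity)] at this
    nlinarith
  induction k with
  | zero =>
    have := hM 0
    simp only [flowIter] at this ⊢
    linarith
  | succ k ih =>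
    have habs : |τ + ε| = τ + ε := abs_of_nonneg (by positivity)
    have hv : ∀ s, |s| ≤ τ + ε → ∀ b, |labelVorticity r (flowIter r k) s b| ≤ V := by
      intro s hs b
      refine abs_labelVorticity_le (τ := τ + ε) (N := M + 1) h.nonneg h.le
        (fun s hs b hb => h.flowIter_le ih (by rwa [habs]) hb) ?_ hs b
      rw [hV]
      gcongr
    have hd := abs_nextFlow_sub_time_le h.smooth.continuous
      (continuous_flowIter h.smooth.continuous k) hv (t := τ + ε) (t' := τ) habs.le
      (by rw [abs_of_nonneg hτ]; linarith) A
    have hd' : Real.exp (V * (τ + ε)) * (V * |τ + ε - τ|) * |A| ≤ C * ε := by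
      rw [add_sub_cancel_left, abs_of_pos hε0, abs_of_pos hA, hC]
      have : Real.exp (V * (τ + ε)) ≤ Real.exp (V * (τ + 1)) := by gcongr
      calc Real.exp (V * (τ + ε)) * (V * ε) * A ≤ Real.exp (V * (τ + 1)) * (V * ε) * A := by
            gcongr
        _ = _ := by ring
    have := le_of_abs_le hd
    have hk := hM (k + 1)
    simp only [flowIter] at hk ⊢
    linarith

/-- `T` is the supremum of the nonnegative times at which the iterates are bounded at `A`. A bound
uniform over `t < T` and `k` would extend past `T`. -/
theorem exists_lifetime (h : IsDensity r R A)
    (hblow : ∃ t : ℝ, ¬ BddAbove (range fun k => flowIter r k t A)) :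
    ∃ T : ℝ, 0 < T ∧ (∀ t : ℝ, |t| < T → BddAbove (range fun k => flowIter r k t A)) ∧
      ∀ M : ℝ, ∃ t ∈ Ico 0 T, ∃ k, M < flowIter r k t A := by
  have hrc := h.smooth.continuous
  set S : Set ℝ := {t | 0 ≤ t ∧ BddAbove (range fun k => flowIter r k t A)} with hS
  have hdown : ∀ t t' : ℝ, |t| ≤ |t'| → BddAbove (range fun k => flowIter r k t' A) →
      BddAbove (range fun k => flowIter r k t A) := by
    rintro t t' htt ⟨M, hM⟩
    refine ⟨M, ?_⟩
    rintro _ ⟨k, rfl⟩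
    exact (flowIter_mono_time hrc h.nonneg k htt h.pos.le).trans (hM ⟨k, rfl⟩)
  have hext : ∀ t M : ℝ, 0 ≤ t → (∀ k, flowIter r k t A ≤ M) → ∃ ε > 0, t + ε ∈ S := by
    intro t M ht hM
    obtain ⟨ε, hε, hk⟩ := h.exists_extension ht hM
    refine ⟨ε, hε, by positivity, M + 1, ?_⟩
    rintro _ ⟨k, rfl⟩
    exact hk k
  obtain ⟨t₁, ht₁⟩ := hblow
  have hbdd : BddAbove S := by
    refine ⟨|t₁|, fun t ht => ?_⟩
    by_contra hc
    exact ht₁ (hdown t₁ t (by rw [abs_of_nonneg ht.1]; exact (not_le.1 hc).le) ht.2)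
  -- At time `0` every iterate is the identity.
  obtain ⟨ε, hε, hεS⟩ := hext 0 A le_rfl fun k => by
    cases k with
    | zero => exact le_rfl
    | succ k => simp [flowIter, nextFlow, logStretch]
  rw [zero_add] at hεS
  have hlt : ∀ t : ℝ, |t| < sSup S → BddAbove (range fun k => flowIter r k t A) := by
    intro t ht
    obtain ⟨t', ht', h'⟩ := exists_lt_of_lt_csSup ⟨ε, hεS⟩ ht
    exact hdown t t' (h'.le.trans (le_abs_self _)) ht'.2
  have hT : 0 < sSup S := hε.trans_le (le_csSup hbdd hεS)
  refine ⟨sSup S, hT, hlt, fun M => ?_⟩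
  by_contra! hM
  -- Each single iterate is continuous in time, so the bound passes to the end time itself.
  have hMT : ∀ k, flowIter r k (sSup S) A ≤ M := fun k => by
    have hc : Continuous fun t => flowIter r k t A :=
      (continuous_flowIter hrc k).comp (by fun_prop : Continuous fun t : ℝ => (t, A))
    refine le_of_tendsto (hc.continuousWithinAt (s := Iio (sSup S))) ?_
    filter_upwards [Ioo_mem_nhdsLT hT] with t ht
    exact hM t ⟨ht.1.le, ht.2⟩ k
  obtain ⟨ε', hε', hS'⟩ := hext (sSup S) M hT.le hMT
  have := le_csSup hbdd hS'
  linarith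

end IsDensity

/-- The limit of the Picard iterates. -/
noncomputable def limitFlow (r : ℝ → ℝ) (t a : ℝ) : ℝ := ⨆ k, flowIter r k t a

/-- The increasing limit passes through the vorticity, the stretch and the flow by dominated
convergence. Continuity of the limit comes from Lipschitz bounds in time and label that are uniform
in `k`. -/
theorem IsDensity.isFlow_limitFlow {r : ℝ → ℝ} {R A T : ℝ} (h : IsDensity r R A)
    (hbd : ∀ t : ℝ, |t| < T → BddAbove (range fun k => flowIter r k t A)) :
    IsFlow r T (limitFlow r) ∧
      ∀ t : ℝ, |t| < T → ∀ k a, flowIter r k t a ≤ limitFlow r t a := by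
  have hrc := h.smooth.continuous
  have hR := h.bound_nonneg
  have hci := fun k => continuous_flowIter hrc k
  -- uniform bounds on `[-τ, τ]`
  have hunif : ∀ τ : ℝ, 0 ≤ τ → τ < T → ∃ N V : ℝ, 0 ≤ V ∧
      (∀ k s, |s| ≤ τ → ∀ b, r b ≠ 0 → flowIter r k s b ≤ N) ∧
      (∀ k s, |s| ≤ τ → ∀ b, |labelVorticity r (flowIter r k) s b| ≤ V) := by
    intro τ hτ hτT
    obtain ⟨N, hN⟩ := hbd τ (by rwa [abs_of_nonneg hτ])
    have hb : ∀ k s, |s| ≤ τ → ∀ b, r b ≠ 0 → flowIter r k s b ≤ N := fun k s hs b hrb =>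
      h.flowIter_le (hN ⟨k, rfl⟩) (by rwa [abs_of_nonneg hτ]) hrb
    exact ⟨N, R * (τ * Real.exp N), by positivity, hb, fun k s hs b =>
      abs_labelVorticity_le h.nonneg h.le (hb k) le_rfl hs b⟩
  have hbdd : ∀ t : ℝ, |t| < T → ∀ a, BddAbove (range fun k => flowIter r k t a) := by
    intro t ht a
    obtain ⟨N, V, -, -, hV⟩ := hunif |t| (abs_nonneg t) ht
    obtain ⟨M, hM⟩ := hbd t ht
    -- The term `a` covers iterate `0`; the later ones are Lipschitz in the label with a common
    -- constant and are compared with `A`.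
    refine ⟨max a (M + Real.exp (V * |t|) * |a - A|), ?_⟩
    rintro _ ⟨k, rfl⟩
    cases k with
    | zero => exact le_max_left _ _
    | succ k =>
      refine le_max_of_le_right ?_
      have h1 := le_of_abs_le (abs_nextFlow_sub_label_le hrc (hci k) (hV k) le_rfl a A)
      have h2 : nextFlow r (flowIter r k) t A ≤ M := hM ⟨k + 1, rfl⟩
      change nextFlow r (flowIter r k) t a ≤ _
      linarith
  have hlim : ∀ t : ℝ, |t| < T → ∀ a,
      Tendsto (fun k => flowIter r k t a) atTop (𝓝 (limitFlow r t a)) := fun t ht a =>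
    tendsto_atTop_ciSup (flowIter_monotone hrc h.nonneg h.left_nonpos t a) (hbdd t ht a)
  have hmem : ∀ {s t : ℝ}, |t| < T → s ∈ uIoc 0 t → |s| ≤ |t| := by
    intro s t _ hs
    simpa using abs_sub_left_of_mem_uIcc (uIoc_subset_uIcc hs)
  have hvort : ∀ t : ℝ, |t| < T → ∀ b, Tendsto (fun k => labelVorticity r (flowIter r k) t b) atTop
      (𝓝 (labelVorticity r (limitFlow r) t b)) := by
    intro t ht b
    by_cases hb : r b = 0
    · simp [labelVorticity, hb]
    obtain ⟨N, V, -, hN, -⟩ := hunif |t| (abs_nonneg t) ht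
    refine Tendsto.const_mul _ ?_
    refine intervalIntegral.tendsto_integral_filter_of_dominated_convergence
      (fun _ => Real.exp N) ?_ ?_ intervalIntegrable_const ?_
    · exact Eventually.of_forall fun k => Continuous.aestronglyMeasurable
        (Real.continuous_exp.comp ((hci k).comp (by fun_prop : Continuous fun s : ℝ => (s, b))))
    · refine Eventually.of_forall fun k => ae_of_all _ fun s hs => ?_
      rw [Real.norm_of_nonneg (Real.exp_pos _).le]
      exact Real.exp_le_exp.2 (hN k s (hmem ht hs) b hb)
    · exact ae_of_all _ fun s hs => (Real.continuous_exp.tendsto _).comp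
        (hlim s ((hmem ht hs).trans_lt ht) b)
  have hstr : ∀ t : ℝ, |t| < T → ∀ b, Tendsto (fun k => logStretch r (flowIter r k) t b) atTop
      (𝓝 (logStretch r (limitFlow r) t b)) := by
    intro t ht b
    obtain ⟨N, V, -, -, hV⟩ := hunif |t| (abs_nonneg t) ht
    refine intervalIntegral.tendsto_integral_filter_of_dominated_convergence
      (fun _ => V) ?_ ?_ intervalIntegrable_const ?_
    · exact Eventually.of_forall fun k => Continuous.aestronglyMeasurable
        ((continuous_labelVorticity hrc (hci k)).comp
          (by fun_prop : Continuous fun s : ℝ => (s, b)))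
    · exact Eventually.of_forall fun k => ae_of_all _ fun s hs => hV k s (hmem ht hs) b
    · exact ae_of_all _ fun s hs => hvort s ((hmem ht hs).trans_lt ht) b
  have hnext : ∀ t : ℝ, |t| < T → ∀ a, Tendsto (fun k => nextFlow r (flowIter r k) t a) atTop
      (𝓝 (nextFlow r (limitFlow r) t a)) := by
    intro t ht a
    obtain ⟨N, V, -, -, hV⟩ := hunif |t| (abs_nonneg t) ht
    refine intervalIntegral.tendsto_integral_filter_of_dominated_convergence
      (fun _ => Real.exp (V * |t|)) ?_ ?_ intervalIntegrable_const ?_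
    · exact Eventually.of_forall fun k => Continuous.aestronglyMeasurable
        (Real.continuous_exp.comp ((continuous_logStretch hrc (hci k)).comp
          (by fun_prop : Continuous fun b : ℝ => (t, b))))
    · refine Eventually.of_forall fun k => ae_of_all _ fun b _ => ?_
      rw [Real.norm_of_nonneg (Real.exp_pos _).le]
      exact Real.exp_le_exp.2 (le_of_abs_le (abs_logStretch_le hrc (hci k) (hV k) le_rfl b))
    · exact ae_of_all _ fun b _ => (Real.continuous_exp.tendsto _).comp (hstr t ht b)
  have hlim1 : ∀ t : ℝ, |t| < T → ∀ a,
      Tendsto (fun k => nextFlow r (flowIter r k) t a) atTop (𝓝 (limitFlow r t a)) :=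
    fun t ht a => (tendsto_add_atTop_iff_nat 1).2 (hlim t ht a)
  refine ⟨⟨?_, fun t ht a => ?_⟩, fun t ht k a => le_ciSup (hbdd t ht a) k⟩
  · rintro ⟨t₀, a₀⟩ ⟨ht₀, -⟩
    have ht₀' : |t₀| < T := abs_lt.2 ht₀
    obtain ⟨τ, h0τ, hτT⟩ := exists_between ht₀'
    have hτ0 : 0 ≤ τ := (abs_nonneg _).trans h0τ.le
    obtain ⟨N, V, hV0, -, hV⟩ := hunif τ hτ0 hτT
    refine ContinuousAt.continuousWithinAt ?_
    have hest : ∀ t a, |t| < τ → |limitFlow r t a - limitFlow r t₀ a₀| ≤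
        Real.exp (V * τ) * (V * |t - t₀|) * |a| + Real.exp (V * τ) * |a - a₀| := by
      intro t a ht
      refine le_of_tendsto ((hlim1 t (ht.trans hτT) a).sub (hlim1 t₀ ht₀' a₀)).abs ?_
      refine Eventually.of_forall fun k => ?_
      have h1 := abs_nextFlow_sub_time_le hrc (hci k) (hV k) ht.le h0τ.le a
      have h2 := abs_nextFlow_sub_label_le hrc (hci k) (hV k) h0τ.le a a₀
      exact (abs_sub_le _ _ _).trans (add_le_add h1 h2)
    have hev : ∀ᶠ p : ℝ × ℝ in 𝓝 (t₀, a₀), |p.1| < τ :=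
      (by fun_prop : Continuous fun p : ℝ × ℝ => |p.1|).continuousAt.eventually
        (gt_mem_nhds h0τ)
    rw [ContinuousAt, tendsto_iff_norm_sub_tendsto_zero]
    refine squeeze_zero' (Eventually.of_forall fun _ => norm_nonneg _)
      (hev.mono fun p hp => hest p.1 p.2 hp) ?_
    have : Continuous fun p : ℝ × ℝ => Real.exp (V * τ) * (V * |p.1 - t₀|) * |p.2| +
        Real.exp (V * τ) * |p.2 - a₀| := by fun_prop
    simpa using! this.tendsto (t₀, a₀)
  · exact tendsto_nhds_unique (hlim1 t (abs_lt.2 ht) a) (hnext t (abs_lt.2 ht) a)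

/-! ### Smoothness of the flow. -/

section Smoothness

variable {r w : ℝ → ℝ} {W Φ Ψ : ℝ × ℝ → ℝ}

/-- The Lagrangian equations after a reparametrization of time with speed `w`. -/
structure IsGlobalFlow (r w : ℝ → ℝ) (W Φ Ψ : ℝ × ℝ → ℝ) : Prop where
  continuous : Continuous W
  vort_eq : ∀ p : ℝ × ℝ, Φ p = r p.2 * ∫ s in (0 : ℝ)..p.1, Real.exp (W (s, p.2)) * w s
  stretch_eq : ∀ p : ℝ × ℝ, Ψ p = ∫ s in (0 : ℝ)..p.1, Φ (s, p.2) * w s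
  flow_eq : ∀ p : ℝ × ℝ, W p = ∫ b in (0 : ℝ)..p.2, Real.exp (Ψ (p.1, b))

namespace IsGlobalFlow

theorem contDiff_vort {n : ℕ} (h : IsGlobalFlow r w W Φ Ψ) (hr : ContDiff ℝ n r)
    (hw : ContDiff ℝ n w) (hW : ContDiff ℝ n W) : ContDiff ℝ n Φ := by
  have h1 : ContDiff ℝ n fun p : ℝ × ℝ => Real.exp (W p) * w p.1 := by fun_prop
  have h2 := contDiff_primitive_fst h1
  rw [show Φ = _ from funext h.vort_eq]
  fun_prop

theorem contDiff_stretch {n : ℕ} (h : IsGlobalFlow r w W Φ Ψ)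
    (hw : ContDiff ℝ n w) (hΦ : ContDiff ℝ n Φ) : ContDiff ℝ n Ψ := by
  have h1 : ContDiff ℝ n fun p : ℝ × ℝ => Φ p * w p.1 := by fun_prop
  rw [show Ψ = _ from funext h.stretch_eq]
  exact contDiff_primitive_fst h1

theorem hasDerivAt_stretch_time (h : IsGlobalFlow r w W Φ Ψ) (hw : Continuous w)
    (hΦ : Continuous Φ) (p : ℝ × ℝ) :
    HasDerivAt (fun t => Ψ (t, p.2)) (Φ p * w p.1) p.1 := by
  simp only [h.stretch_eq]
  exact hasDerivAt_primitive_fst (F := fun p : ℝ × ℝ => Φ p * w p.1) (by fun_prop) p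

theorem hasDerivAt_vort_time (h : IsGlobalFlow r w W Φ Ψ) (hw : Continuous w)
    (p : ℝ × ℝ) :
    HasDerivAt (fun t => Φ (t, p.2)) (r p.2 * (Real.exp (W p) * w p.1)) p.1 := by
  have hc := h.continuous
  simp only [h.vort_eq]
  exact (hasDerivAt_primitive_fst (F := fun p : ℝ × ℝ => Real.exp (W p) * w p.1)
    (by fun_prop) p).const_mul _

theorem hasDerivAt_flow_label (h : IsGlobalFlow r w W Φ Ψ) (hΨ : Continuous Ψ) (p : ℝ × ℝ) :
    HasDerivAt (fun a => W (p.1, a)) (Real.exp (Ψ p)) p.2 := by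
  simp only [h.flow_eq]
  exact hasDerivAt_primitive_snd (F := fun p => Real.exp (Ψ p)) (by fun_prop) p

theorem hasDerivAt_flow_time (h : IsGlobalFlow r w W Φ Ψ) (hw : Continuous w)
    (hΦ : Continuous Φ) (hΨ : Continuous Ψ) (p : ℝ × ℝ) :
    HasDerivAt (fun t => W (t, p.2))
      (∫ b in (0 : ℝ)..p.2, Real.exp (Ψ (p.1, b)) * (Φ (p.1, b) * w p.1)) p.1 := by
  simp only [h.flow_eq]
  exact hasDerivAt_parametric_integral (F := fun p => Real.exp (Ψ p))
    (F₁ := fun p => Real.exp (Ψ p) * (Φ p * w p.1)) (by fun_prop) (by fun_prop)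
    (fun p => (h.hasDerivAt_stretch_time hw hΦ p).exp) p.2 p.1

/-- Bootstrap: if `W` is of class `C^n`, so are `Φ` and `Ψ`, and both partials of `W` are built from
these by integration and exponentials, so `W` is of class `C^(n+1)`. -/
theorem contDiff_nat (h : IsGlobalFlow r w W Φ Ψ) (hr : ∀ n : ℕ, ContDiff ℝ n r)
    (hw : ∀ n : ℕ, ContDiff ℝ n w) (n : ℕ) : ContDiff ℝ n W := by
  induction n with
  | zero => exact contDiff_zero.2 h.continuous
  | succ n ih =>
    have hΦ := h.contDiff_vort (hr n) (hw n) ih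
    have hΨ := h.contDiff_stretch (hw n) hΦ
    have hwn := hw n
    refine contDiff_succ_of_partials
      (h.hasDerivAt_flow_time (hw 0).continuous hΦ.continuous hΨ.continuous)
      (h.hasDerivAt_flow_label hΨ.continuous) ?_ (by fun_prop)
    exact contDiff_primitive_snd (F := fun p => Real.exp (Ψ p) * (Φ p * w p.1)) (by fun_prop)

end IsGlobalFlow

/-- A smooth time change with values in `(-T, T)` that is the identity near a given time. -/
theorem exists_time_change {T t₀ : ℝ} (ht₀ : t₀ ∈ Ioo (-T) T) :
    ∃ χ : ℝ → ℝ, ContDiff ℝ ((⊤ : ℕ∞) : WithTop ℕ∞) χ ∧ χ 0 = 0 ∧ (∀ t, χ t ∈ Ioo (-T) T) ∧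
      ∀ᶠ t in 𝓝 t₀, χ t = t := by
  have h0 : |t₀| < T := abs_lt.2 ht₀
  obtain ⟨s, hs, hsT⟩ := exists_between h0
  obtain ⟨s', hs', hsT'⟩ := exists_between hsT
  have hs0 : 0 < s := (abs_nonneg _).trans_lt hs
  let β : ContDiffBump (0 : ℝ) := ⟨s, s', hs0, hs'⟩
  refine ⟨fun t => t * β t, contDiff_id.mul β.contDiff, by simp, fun t => ?_, ?_⟩
  · refine abs_lt.1 ?_
    rw [abs_mul, abs_of_nonneg β.nonneg]
    by_cases ht : |t| < s'
    · calc |t| * β t ≤ |t| * 1 := by gcongr; exact β.le_one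
        _ < T := by linarith
    · rw [β.zero_of_le_dist (by simpa [β] using not_lt.1 ht), mul_zero]
      linarith
  · have : ∀ᶠ t : ℝ in 𝓝 t₀, |t| < s :=
      continuous_abs.continuousAt.eventually (gt_mem_nhds hs)
    filter_upwards [this] with t ht
    rw [β.one_of_mem_closedBall (by simpa [β] using ht.le), mul_one]

end Smoothness

/-- The speed of the flow `Z` at time `t` of the particle with label `a`. -/
noncomputable def flowSpeed (r : ℝ → ℝ) (Z : ℝ → ℝ → ℝ) (t a : ℝ) : ℝ :=
  ∫ b in (0 : ℝ)..a, Real.exp (logStretch r Z t b) * labelVorticity r Z t b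

namespace IsFlow

variable {r : ℝ → ℝ} {T : ℝ} {Z : ℝ → ℝ → ℝ}

/-- Composing with a time change `χ` into `(-T, T)` gives a flow defined on the whole plane, to
which the global calculus lemmas apply. The substitution `s ↦ χ s` keeps the integral equations,
with weight `w = deriv χ`, because `χ 0 = 0`; near `t₀` nothing changes. -/
theorem exists_isGlobalFlow (h : IsFlow r T Z) {t₀ : ℝ} (ht₀ : t₀ ∈ Ioo (-T) T) :
    ∃ (w : ℝ → ℝ) (W Φ Ψ : ℝ × ℝ → ℝ), IsGlobalFlow r w W Φ Ψ ∧ w t₀ = 1 ∧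
      (∀ n : ℕ, ContDiff ℝ n w) ∧ ∀ᶠ t in 𝓝 t₀, ∀ a, Z t a = W (t, a) ∧
        labelVorticity r Z t a = Φ (t, a) ∧ logStretch r Z t a = Ψ (t, a) := by
  obtain ⟨χ, hχ, hχ0, hmem, hid⟩ := exists_time_change ht₀
  have hT : 0 < T := by have := ht₀.1.trans ht₀.2; linarith
  have hd : ∀ t, HasDerivAt χ (deriv χ t) t := fun t =>
    (hχ.differentiable (by simp) t).hasDerivAt
  have hχ' : ContDiff ℝ ((⊤ : ℕ∞) : WithTop ℕ∞) (deriv χ) := (contDiff_infty_iff_deriv.1 hχ).2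
  have hW : Continuous fun p : ℝ × ℝ => Z (χ p.1) p.2 := by
    have hχc := hχ.continuous
    exact h.continuousOn.comp_continuous (f := fun p : ℝ × ℝ => (χ p.1, p.2)) (by fun_prop)
      fun p => ⟨hmem p.1, mem_univ _⟩
  have hsub : ∀ (g : ℝ → ℝ), ContinuousOn g (Ioo (-T) T) → ∀ t,
      ∫ s in (0 : ℝ)..χ t, g s = ∫ s in (0 : ℝ)..t, g (χ s) * deriv χ s := by
    intro g hg t
    have := intervalIntegral.integral_comp_mul_deriv' (a := 0) (b := t) (f := χ)
      (f' := deriv χ) (g := g) (fun x _ => hd x) hχ'.continuous.continuousOn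
      (hg.mono (by rintro _ ⟨x, _, rfl⟩; exact hmem x))
    rw [hχ0] at this
    exact this.symm
  have hZc : ∀ a, ContinuousOn (fun s => Z s a) (Ioo (-T) T) := fun a =>
    h.continuousOn.comp (f := fun s : ℝ => (s, a)) (by fun_prop) fun s hs => ⟨hs, mem_univ _⟩
  have hvc : ∀ a, ContinuousOn (fun s => labelVorticity r Z s a) (Ioo (-T) T) := by
    intro a
    refine ContinuousOn.mul continuousOn_const fun t ht => ContinuousAt.continuousWithinAt ?_
    have hexp : ContinuousOn (fun s => Real.exp (Z s a)) (Ioo (-T) T) :=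
      Real.continuous_exp.comp_continuousOn (hZc a)
    have h0 : (0 : ℝ) ∈ Ioo (-T) T := ⟨by linarith, hT⟩
    have hsub' : uIcc 0 t ⊆ Ioo (-T) T := (ordConnected_Ioo).uIcc_subset h0 ht
    exact (intervalIntegral.integral_hasDerivAt_right
      ((hexp.mono hsub').intervalIntegrable)
      (hexp.stronglyMeasurableAtFilter isOpen_Ioo t ht)
      (hexp.continuousAt (isOpen_Ioo.mem_nhds ht))).continuousAt
  refine ⟨deriv χ, fun p => Z (χ p.1) p.2, fun p => labelVorticity r Z (χ p.1) p.2,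
    fun p => logStretch r Z (χ p.1) p.2, ⟨hW, fun p => ?_, fun p => ?_, fun p => ?_⟩, ?_,
    fun n => hχ'.of_le (by exact_mod_cast le_top), ?_⟩
  · simp only [labelVorticity]
    rw [hsub (fun s => Real.exp (Z s p.2)) (Real.continuous_exp.comp_continuousOn (hZc p.2))]
  · simp only [logStretch]
    rw [hsub _ (hvc p.2)]
  · exact h.eq _ (hmem p.1) p.2
  · have := (hasDerivAt_id t₀).congr_of_eventuallyEq (f₁ := χ) hid
    exact this.deriv
  · filter_upwards [hid] with t ht a
    simp [ht]

variable {t : ℝ}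

theorem eventually_prod {P : ℝ → ℝ → Prop} (h : ∀ᶠ t in 𝓝 t, ∀ a, P t a) (a : ℝ) :
    ∀ᶠ p : ℝ × ℝ in 𝓝 (t, a), P p.1 p.2 :=
  (continuous_fst.tendsto (t, a)).eventually h |>.mono fun p hp => hp p.2

theorem contDiffAt (h : IsFlow r T Z) (hr : ContDiff ℝ ((⊤ : ℕ∞) : WithTop ℕ∞) r)
    (ht : t ∈ Ioo (-T) T) (a : ℝ) :
    ContDiffAt ℝ ((⊤ : ℕ∞) : WithTop ℕ∞) (Function.uncurry Z) (t, a) ∧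
    ContDiffAt ℝ ((⊤ : ℕ∞) : WithTop ℕ∞) (Function.uncurry (labelVorticity r Z)) (t, a) ∧
    ContDiffAt ℝ ((⊤ : ℕ∞) : WithTop ℕ∞) (Function.uncurry (logStretch r Z)) (t, a) := by
  obtain ⟨w, W, Φ, Ψ, hG, -, hw, hev⟩ := h.exists_isGlobalFlow ht
  have hrn : ∀ n : ℕ, ContDiff ℝ n r := fun n => hr.of_le (by exact_mod_cast le_top)
  have hW := hG.contDiff_nat hrn hw
  have hΦ := fun n => hG.contDiff_vort (hrn n) (hw n) (hW n)
  have hΨ := fun n => hG.contDiff_stretch (hw n) (hΦ n)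
  have hev' := eventually_prod hev a
  exact ⟨(contDiff_infty.2 hW).contDiffAt.congr_of_eventuallyEq (hev'.mono fun p hp => hp.1),
    (contDiff_infty.2 hΦ).contDiffAt.congr_of_eventuallyEq (hev'.mono fun p hp => hp.2.1),
    (contDiff_infty.2 hΨ).contDiffAt.congr_of_eventuallyEq (hev'.mono fun p hp => hp.2.2)⟩

theorem hasDerivAt (h : IsFlow r T Z) (hr : ContDiff ℝ ((⊤ : ℕ∞) : WithTop ℕ∞) r)
    (ht : t ∈ Ioo (-T) T) (a : ℝ) :
    HasDerivAt (fun s => labelVorticity r Z s a) (r a * Real.exp (Z t a)) t ∧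
    HasDerivAt (fun s => logStretch r Z s a) (labelVorticity r Z t a) t ∧
    HasDerivAt (Z t) (Real.exp (logStretch r Z t a)) a ∧
    HasDerivAt (fun s => Z s a) (flowSpeed r Z t a) t ∧
    HasDerivAt (flowSpeed r Z t)
      (Real.exp (logStretch r Z t a) * labelVorticity r Z t a) a := by
  obtain ⟨w, W, Φ, Ψ, hG, hw1, hw, hev⟩ := h.exists_isGlobalFlow ht
  have hrn : ∀ n : ℕ, ContDiff ℝ n r := fun n => hr.of_le (by exact_mod_cast le_top)
  have hW := hG.contDiff_nat hrn hw
  have hΦ := fun n => hG.contDiff_vort (hrn n) (hw n) (hW n)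
  have hΨ := fun n => hG.contDiff_stretch (hw n) (hΦ n)
  have hΦc := (hΦ 0).continuous
  have hΨc := (hΨ 0).continuous
  have hnow := hev.self_of_nhds
  have hspeed : flowSpeed r Z t = fun a =>
      ∫ b in (0 : ℝ)..a, Real.exp (Ψ (t, b)) * (Φ (t, b) * w t) := by
    funext a
    simp only [flowSpeed, hw1, mul_one]
    exact intervalIntegral.integral_congr fun b _ => by simp only [(hnow b).2.1, (hnow b).2.2]
  refine ⟨?_, ?_, ?_, ?_, ?_⟩
  · have := (hG.hasDerivAt_vort_time (hw 0).continuous (t, a)).congr_of_eventuallyEq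
      (hev.mono fun s hs => (hs a).2.1)
    simpa [hw1, (hnow a).1] using this
  · have := (hG.hasDerivAt_stretch_time (hw 0).continuous hΦc (t, a)).congr_of_eventuallyEq
      (hev.mono fun s hs => (hs a).2.2)
    simpa [hw1, (hnow a).2.1] using this
  · have e : Z t = fun a => W (t, a) := funext fun a => (hnow a).1
    rw [e, (hnow a).2.2]
    exact hG.hasDerivAt_flow_label hΨc (t, a)
  · rw [hspeed]
    exact (hG.hasDerivAt_flow_time (hw 0).continuous hΦc hΨc (t, a)).congr_of_eventuallyEq
      (hev.mono fun s hs => (hs a).1)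
  · rw [hspeed, (hnow a).2.1, (hnow a).2.2]
    have := hasDerivAt_primitive_snd (F := fun p => Real.exp (Ψ p) * (Φ p * w t)) (by fun_prop)
      (t, a)
    simpa [hw1] using this

end IsFlow

/-! ### The flow breaks down by time `5`. -/

namespace IsFlow

variable {r : ℝ → ℝ} {T R A t : ℝ} {Z : ℝ → ℝ → ℝ}

theorem strictMono_label (h : IsFlow r T Z) (hr : ContDiff ℝ ((⊤ : ℕ∞) : WithTop ℕ∞) r)
    (ht : t ∈ Ioo (-T) T) : StrictMono (Z t) := by
  refine strictMono_of_deriv_pos fun a => ?_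
  rw [(h.hasDerivAt hr ht a).2.2.1.deriv]
  exact Real.exp_pos _

theorem apply_zero (h : IsFlow r T Z) (ht : t ∈ Ioo (-T) T) : Z t 0 = 0 := by
  simp [h.eq t ht, nextFlow]

theorem nonneg (h : IsFlow r T Z) (hr : ContDiff ℝ ((⊤ : ℕ∞) : WithTop ℕ∞) r)
    (ht : t ∈ Ioo (-T) T) {a : ℝ} (ha : 0 ≤ a) : 0 ≤ Z t a := by
  rw [← h.apply_zero ht]
  exact (h.strictMono_label hr ht).monotone ha

theorem flowSpeed_nonneg (hr : ∀ a, 0 ≤ r a) (ht : 0 ≤ t) {a : ℝ} (ha : 0 ≤ a) :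
    0 ≤ flowSpeed r Z t a :=
  intervalIntegral.integral_nonneg ha fun b _ =>
    mul_nonneg (Real.exp_pos _).le (labelVorticity_nonneg hr ht b)

theorem uIcc_zero_subset (ht : t ∈ Ioo (-T) T) : uIcc 0 t ⊆ Ioo (-T) T :=
  (ordConnected_Ioo).uIcc_subset ⟨by linarith [ht.1.trans ht.2], by linarith [ht.1.trans ht.2]⟩ ht

theorem intervalIntegrable_exp (h : IsFlow r T Z)
    (hr : ContDiff ℝ ((⊤ : ℕ∞) : WithTop ℕ∞) r) (ht : t ∈ Ioo (-T) T) (a : ℝ) :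
    IntervalIntegrable (fun s => Real.exp (Z s a)) volume 0 t :=
  ContinuousOn.intervalIntegrable fun _ hs => ((h.hasDerivAt hr
    (uIcc_zero_subset ht hs) a).2.2.2.1.continuousAt.rexp).continuousWithinAt

theorem intervalIntegrable_labelVorticity (h : IsFlow r T Z)
    (hr : ContDiff ℝ ((⊤ : ℕ∞) : WithTop ℕ∞) r) (ht : t ∈ Ioo (-T) T) (a : ℝ) :
    IntervalIntegrable (fun s => labelVorticity r Z s a) volume 0 t :=
  ContinuousOn.intervalIntegrable fun _ hs => ((h.hasDerivAt hr
    (uIcc_zero_subset ht hs) a).1.continuousAt).continuousWithinAt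

/-- Where `r` is constant, the vorticity inherits the monotonicity of `Z` in the label. -/
theorem labelVorticity_monotoneOn (h : IsFlow r T Z)
    (hr : ContDiff ℝ ((⊤ : ℕ∞) : WithTop ℕ∞) r) {s : Set ℝ} {c : ℝ} (hc : 0 ≤ c)
    (hs : ∀ a ∈ s, r a = c) (ht0 : 0 ≤ t) (ht : t < T) :
    MonotoneOn (labelVorticity r Z t) s := by
  intro a ha b hb hab
  have htT : t ∈ Ioo (-T) T := ⟨by linarith, ht⟩
  rw [labelVorticity, labelVorticity, hs a ha, hs b hb]
  refine mul_le_mul_of_nonneg_left ?_ hc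
  refine intervalIntegral.integral_mono_on ht0 (h.intervalIntegrable_exp hr htT a)
    (h.intervalIntegrable_exp hr htT b) fun σ hσ => Real.exp_le_exp.2 ?_
  exact (h.strictMono_label hr ⟨by linarith [hσ.1], by linarith [hσ.2]⟩).monotone hab

theorem logStretch_monotoneOn (h : IsFlow r T Z)
    (hr : ContDiff ℝ ((⊤ : ℕ∞) : WithTop ℕ∞) r) {s : Set ℝ} {c : ℝ} (hc : 0 ≤ c)
    (hs : ∀ a ∈ s, r a = c) (ht0 : 0 ≤ t) (ht : t < T) :
    MonotoneOn (logStretch r Z t) s := by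
  intro a ha b hb hab
  have htT : t ∈ Ioo (-T) T := ⟨by linarith, ht⟩
  exact intervalIntegral.integral_mono_on ht0 (h.intervalIntegrable_labelVorticity hr htT a)
    (h.intervalIntegrable_labelVorticity hr htT b) fun σ hσ =>
      h.labelVorticity_monotoneOn hr hc hs hσ.1 (hσ.2.trans_lt ht) ha hb hab

theorem hasDerivAt_along {f : ℝ → ℝ → ℝ} {y : ℝ → ℝ} {s d e y' : ℝ}
    (hf : DifferentiableAt ℝ (Function.uncurry f) (s, y s))
    (h₁ : HasDerivAt (fun σ => f σ (y s)) d s) (h₂ : HasDerivAt (f s) e (y s))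
    (hy : HasDerivAt y y' s) :
    HasDerivAt (fun σ => f σ (y σ)) (d + e * y') s := by
  have hL := hf.hasFDerivAt
  set L := fderiv ℝ (Function.uncurry f) (s, y s)
  have e1 : L (1, 0) = d := by
    have hg : HasDerivAt (fun σ : ℝ => (σ, y s)) ((1 : ℝ), (0 : ℝ)) s :=
      HasDerivAt.prodMk (hasDerivAt_id s) (hasDerivAt_const s (y s))
    have h3 := HasFDerivAt.comp_hasDerivAt s hL hg
    exact h3.unique h₁
  have e2 : L (0, 1) = e := by
    have hg : HasDerivAt (fun a : ℝ => (s, a)) ((0 : ℝ), (1 : ℝ)) (y s) :=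
      HasDerivAt.prodMk (hasDerivAt_const (y s) s) (hasDerivAt_id (y s))
    have h3 := HasFDerivAt.comp_hasDerivAt (y s) hL hg
    exact h3.unique h₂
  have hg : HasDerivAt (fun σ : ℝ => (σ, y σ)) ((1 : ℝ), y') s :=
    HasDerivAt.prodMk (hasDerivAt_id s) hy
  have h3 := HasFDerivAt.comp_hasDerivAt s hL hg
  rw [show ((1 : ℝ), y') = (1, 0) + y' • (0, 1) by simp, map_add, map_smul, e1, e2,
    smul_eq_mul, mul_comm] at h3
  exact h3

theorem hasDerivAt_diagonal {f : ℝ → ℝ → ℝ} {s d e : ℝ}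
    (hf : DifferentiableAt ℝ (Function.uncurry f) (s, 1 + s))
    (h₁ : HasDerivAt (fun σ => f σ (1 + s)) d s) (h₂ : HasDerivAt (f s) e (1 + s)) :
    HasDerivAt (fun σ => f σ (1 + σ)) (d + e) s := by
  simpa using hasDerivAt_along (y := fun σ => 1 + σ) hf h₁ h₂ ((hasDerivAt_id s).const_add 1)

/-- Moving the label outwards adds the label derivative, which is nonnegative by monotonicity; the
time derivative therefore bounds the diagonal one from below. -/
theorem exists_hasDerivAt_diagonal {f : ℝ → ℝ → ℝ} {s d : ℝ} {S : Set ℝ}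
    (hf : DifferentiableAt ℝ (Function.uncurry f) (s, 1 + s))
    (h₁ : HasDerivAt (fun σ => f σ (1 + s)) d s) (hS : S ∈ 𝓝 (1 + s))
    (hm : MonotoneOn (f s) S) :
    ∃ d', d ≤ d' ∧ HasDerivAt (fun σ => f σ (1 + σ)) d' s := by
  have h₂ : DifferentiableAt ℝ (f s) (1 + s) := by
    have : DifferentiableAt ℝ (fun a : ℝ => (s, a)) (1 + s) := by fun_prop
    exact DifferentiableAt.comp (g := Function.uncurry f) (1 + s) hf this
  have he : 0 ≤ deriv (f s) (1 + s) := by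
    rw [← derivWithin_of_mem_nhds hS]
    exact hm.derivWithin_nonneg
  exact ⟨_, le_add_of_nonneg_right he, hasDerivAt_diagonal hf h₁ h₂.hasDerivAt⟩

/-- Put `κ = log q` and let `m` be the exponent on the left. If `p ≤ m` and `κ ≤ m`, then `G - κ = 4
m - p - 2 κ ≥ m`. So one of the three terms on the right always dominates. -/
theorem exp_quarter_le {p q G : ℝ} (hq : 0 < q) :
    Real.exp ((G + p + Real.log q) / 4) ≤ Real.exp p + q + 4 * Real.exp G / q := by
  obtain ⟨κ, rfl⟩ : ∃ κ, q = Real.exp κ := ⟨Real.log q, (Real.exp_log hq).symm⟩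
  rw [Real.log_exp, mul_div_assoc, ← Real.exp_sub]
  have h1 := Real.exp_pos p
  have h2 := Real.exp_pos κ
  have h3 := Real.exp_pos (G - κ)
  set m := (G + p + κ) / 4 with hm
  rcases le_total m p with h | h
  · linarith [Real.exp_le_exp.2 h]
  rcases le_total m κ with h' | h'
  · linarith [Real.exp_le_exp.2 h']
  · have : m ≤ G - κ := by linarith
    linarith [Real.exp_le_exp.2 this]

/-- The label moves at unit speed because the label derivative of `Z` is `exp p`: this turns the
nonlocal speed of the flow into the local inequality `G' ≥ exp p` and closes the system for `G`,
`p`, `q`. -/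
theorem lifetime_le (h : IsFlow r T Z) (hr : ContDiff ℝ ((⊤ : ℕ∞) : WithTop ℕ∞) r)
    (hr0 : ∀ a, 0 ≤ r a) (hr4 : ∀ a ∈ Icc (1 : ℝ) 6, r a = 4) : T ≤ 5 := by
  by_contra! hT
  have hmem : ∀ s ∈ Icc (1 : ℝ) 5, s ∈ Ioo (-T) T := fun s hs =>
    ⟨by linarith [hs.1], by linarith [hs.2]⟩
  set G : ℝ → ℝ := fun s => Z s (1 + s)
  set p : ℝ → ℝ := fun s => logStretch r Z s (1 + s)
  set q : ℝ → ℝ := fun s => labelVorticity r Z s (1 + s)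
  -- Since `Z ≥ 0`, the vorticity is at least `4 s`. Starting at time `1` keeps `log q` defined and
  -- nonnegative.
  have hq_ge : ∀ s ∈ Icc (1 : ℝ) 5, 4 ≤ q s := by
    intro s hs
    have hi : s ≤ ∫ σ in (0 : ℝ)..s, Real.exp (Z σ (1 + s)) := by
      have := intervalIntegral.integral_mono_on (μ := volume) (a := 0) (b := s)
        (by linarith [hs.1]) (intervalIntegrable_const (c := (1 : ℝ)))
        (h.intervalIntegrable_exp hr (hmem s hs) (1 + s)) fun σ hσ =>
          Real.one_le_exp (h.nonneg hr ⟨by linarith [hσ.1], by linarith [hσ.2, hs.2]⟩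
            (by linarith [hs.1]))
      simpa using this
    change 4 ≤ r (1 + s) * _
    rw [hr4 (1 + s) ⟨by linarith [hs.1], by linarith [hs.2]⟩]
    linarith [hs.1]
  have hG : ∀ s ∈ Icc (1 : ℝ) 5, ∃ d, Real.exp (p s) ≤ d ∧ HasDerivAt G d s := by
    intro s hs
    have hd := h.hasDerivAt hr (hmem s hs) (1 + s)
    refine ⟨_, ?_, hasDerivAt_diagonal ((h.contDiffAt hr (hmem s hs) (1 + s)).1.differentiableAt
      (by simp)) hd.2.2.2.1 hd.2.2.1⟩
    exact le_add_of_nonneg_left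
      (flowSpeed_nonneg hr0 (by linarith [hs.1]) (by linarith [hs.1]))
  have hnhds : ∀ s ∈ Ioo (1 : ℝ) 5, Icc (1 : ℝ) 6 ∈ 𝓝 (1 + s) := fun s hs =>
    Icc_mem_nhds (by linarith [hs.1]) (by linarith [hs.2])
  have hp : ∀ s ∈ Ioo (1 : ℝ) 5, ∃ d, q s ≤ d ∧ HasDerivAt p d s := fun s hs =>
    exists_hasDerivAt_diagonal
      ((h.contDiffAt hr (hmem s ⟨hs.1.le, hs.2.le⟩) (1 + s)).2.2.differentiableAt (by simp))
      (h.hasDerivAt hr (hmem s ⟨hs.1.le, hs.2.le⟩) (1 + s)).2.1 (hnhds s hs)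
      (h.logStretch_monotoneOn hr (by norm_num) hr4 (by linarith [hs.1]) (by linarith [hs.2]))
  have hq : ∀ s ∈ Ioo (1 : ℝ) 5, ∃ d, 4 * Real.exp (G s) ≤ d ∧ HasDerivAt q d s := by
    intro s hs
    have := exists_hasDerivAt_diagonal
      ((h.contDiffAt hr (hmem s ⟨hs.1.le, hs.2.le⟩) (1 + s)).2.1.differentiableAt (by simp))
      (h.hasDerivAt hr (hmem s ⟨hs.1.le, hs.2.le⟩) (1 + s)).1 (hnhds s hs)
      (h.labelVorticity_monotoneOn hr (by norm_num) hr4 (by linarith [hs.1])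
        (by linarith [hs.2]))
    rwa [hr4 (1 + s) ⟨by linarith [hs.1], by linarith [hs.2]⟩] at this
  -- For `S = G + p + log q` the inequalities give `S' ≥ exp (S / 4)`, so `K = exp (-S / 4)` falls
  -- at rate at least `1/4`. From `K 1 ≤ 1` it would reach `0` by time `5`.
  set K : ℝ → ℝ := fun s => Real.exp (-((G s + p s + Real.log (q s)) / 4)) with hK
  have hder : ∀ s ∈ Ioo (1 : ℝ) 5, ∃ d, d ≤ 0 ∧ HasDerivAt (fun s => K s + s / 4) d s := by
    intro s hs
    obtain ⟨d₁, hd₁, h₁⟩ := hG s ⟨hs.1.le, hs.2.le⟩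
    obtain ⟨d₂, hd₂, h₂⟩ := hp s hs
    obtain ⟨d₃, hd₃, h₃⟩ := hq s hs
    have hqs : 0 < q s := by linarith [hq_ge s ⟨hs.1.le, hs.2.le⟩]
    refine ⟨_, ?_, (((((h₁.add h₂).add (h₃.log hqs.ne')).div_const 4).neg).exp).add
      ((hasDerivAt_id s).div_const 4)⟩
    have key := exp_quarter_le (p := p s) (G := G s) hqs
    have hE := Real.exp_pos ((G s + p s + Real.log (q s)) / 4)
    have hdiv : 4 * Real.exp (G s) / q s ≤ d₃ / q s := by gcongr
    have hsum : Real.exp ((G s + p s + Real.log (q s)) / 4) ≤ d₁ + d₂ + d₃ / q s := by linarith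
    simp only [Pi.add_apply, Pi.neg_apply] at *
    have hone : Real.exp (-((G s + p s + Real.log (q s)) / 4)) *
        Real.exp ((G s + p s + Real.log (q s)) / 4) = 1 := by
      rw [← Real.exp_add]; simp
    have := mul_le_mul_of_nonneg_left hsum (Real.exp_pos (-((G s + p s + Real.log (q s)) / 4))).le
    rw [hone] at this
    linarith
  have hcont : ContinuousOn (fun s => K s + s / 4) (Icc 1 5) := by
    intro s hs
    have hpair : ContinuousAt (fun s : ℝ => (s, 1 + s)) s := by fun_prop
    have c := h.contDiffAt hr (hmem s hs) (1 + s)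
    have c₁ : ContinuousAt G s := ContinuousAt.comp (f := fun s : ℝ => (s, 1 + s))
      (g := Function.uncurry Z) c.1.continuousAt hpair
    have c₂ : ContinuousAt p s := ContinuousAt.comp (f := fun s : ℝ => (s, 1 + s))
      (g := Function.uncurry (logStretch r Z)) c.2.2.continuousAt hpair
    have c₃ : ContinuousAt q s := ContinuousAt.comp (f := fun s : ℝ => (s, 1 + s))
      (g := Function.uncurry (labelVorticity r Z)) c.2.1.continuousAt hpair
    have hqs : q s ≠ 0 := by linarith [hq_ge s hs]
    exact (ContinuousAt.add ((((c₁.add c₂).add (c₃.log hqs)).div_const 4).neg.rexp)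
      (continuousAt_id.div_const 4)).continuousWithinAt
  have hanti : AntitoneOn (fun s => K s + s / 4) (Icc 1 5) := by
    refine antitoneOn_of_deriv_nonpos (convex_Icc 1 5) hcont ?_ ?_
    · rw [interior_Icc]
      intro s hs
      obtain ⟨d, -, hd⟩ := hder s hs
      exact hd.differentiableAt.differentiableWithinAt
    · rw [interior_Icc]
      intro s hs
      obtain ⟨d, hd0, hd⟩ := hder s hs
      rwa [hd.deriv]
  have h15 := hanti (left_mem_Icc.2 (by norm_num)) (right_mem_Icc.2 (by norm_num))
    (by norm_num : (1 : ℝ) ≤ 5)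
  have hK5 : 0 < K 5 := Real.exp_pos _
  have hK1 : K 1 ≤ 1 := by
    have h1 : (1 : ℝ) ∈ Icc (1 : ℝ) 5 := by norm_num
    rw [hK, Real.exp_le_one_iff]
    have hG1 : 0 ≤ G 1 := h.nonneg hr (hmem 1 h1) (by norm_num)
    have hp1 : 0 ≤ p 1 := logStretch_nonneg hr0 zero_le_one _
    have hl1 : 0 ≤ Real.log (q 1) := Real.log_nonneg (by linarith [hq_ge 1 h1])
    linarith
  simp only at h15
  linarith

end IsFlow

/-! ### Return to the variable `x`. -/

/-- The label of the particle which the flow `Z` has carried to `z` at time `t`. -/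
noncomputable def flowLabel (Z : ℝ → ℝ → ℝ) (t z : ℝ) : ℝ := Function.invFun (Z t) z

/-- A function of time and label as a function of time and `x`. -/
noncomputable def eulerian (Z g : ℝ → ℝ → ℝ) (t x : ℝ) : ℝ :=
  if 0 < x then g t (flowLabel Z t (-Real.log x)) else 0

namespace IsFlow

variable {r : ℝ → ℝ} {R A T t : ℝ} {Z : ℝ → ℝ → ℝ}

/-- No density lies at or below such a label, hence no stretch. This keeps the supports away from `x
= 1`. -/
theorem eq_self (h : IsFlow r T Z) (hr : IsDensity r R A) (ht : t ∈ Ioo (-T) T) {a : ℝ}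
    (ha : a ≤ 1 / 2) : Z t a = a := by
  rw [h.eq t ht, nextFlow]
  have : ∫ b in (0 : ℝ)..a, Real.exp (logStretch r Z t b) = ∫ b in (0 : ℝ)..a, (1 : ℝ) := by
    refine intervalIntegral.integral_congr fun b hb => ?_
    have hb' : b ≤ 1 / 2 := by
      rcases mem_uIcc.1 hb with h | h <;> linarith [h.2]
    simp [logStretch_of_eq_zero (hr.left b hb')]
  simpa using this

theorem eq_add (h : IsFlow r T Z) (hr : IsDensity r R A) (ht : t ∈ Ioo (-T) T) {a : ℝ}
    (ha : A ≤ a) : Z t a = Z t A + (a - A) := by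
  have hi : ∀ a b : ℝ, IntervalIntegrable (fun b => Real.exp (logStretch r Z t b)) volume a b := by
    intro a b
    refine Continuous.intervalIntegrable (continuous_iff_continuousAt.2 fun b => ?_) _ _
    exact (ContinuousAt.comp (f := fun b : ℝ => (t, b)) (g := Function.uncurry (logStretch r Z))
      (h.contDiffAt hr.smooth ht b).2.2.continuousAt (by fun_prop)).rexp
  rw [h.eq t ht a, h.eq t ht A, nextFlow, nextFlow,
    ← intervalIntegral.integral_add_adjacent_intervals (hi 0 A) (hi A a)]
  have : ∫ b in A..a, Real.exp (logStretch r Z t b) = ∫ b in A..a, (1 : ℝ) := by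
    refine intervalIntegral.integral_congr fun b hb => ?_
    rw [uIcc_of_le ha] at hb
    simp [logStretch_of_eq_zero (hr.right b hb.1)]
  rw [this]
  simp

theorem continuous_label (h : IsFlow r T Z) (hr : IsDensity r R A) (ht : t ∈ Ioo (-T) T) :
    Continuous (Z t) :=
  continuous_iff_continuousAt.2 fun a => (h.hasDerivAt hr.smooth ht a).2.2.1.continuousAt

theorem surjective (h : IsFlow r T Z) (hr : IsDensity r R A) (ht : t ∈ Ioo (-T) T) :
    Function.Surjective (Z t) := by
  refine (h.continuous_label hr ht).surjective ?_ ?_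
  · refine tendsto_atTop_mono' atTop ?_ (tendsto_atTop_add_const_left atTop (Z t A - A) tendsto_id)
    filter_upwards [eventually_ge_atTop A] with a ha
    rw [h.eq_add hr ht ha]
    simp only [id]; linarith
  · refine tendsto_id.congr' ?_
    filter_upwards [eventually_le_atBot (1 / 2 : ℝ)] with a ha
    exact (h.eq_self hr ht ha).symm

theorem flow_flowLabel (h : IsFlow r T Z) (hr : IsDensity r R A) (ht : t ∈ Ioo (-T) T) (z : ℝ) :
    Z t (flowLabel Z t z) = z :=
  Function.rightInverse_invFun (h.surjective hr ht) z

theorem flowLabel_flow (h : IsFlow r T Z) (hr : IsDensity r R A) (ht : t ∈ Ioo (-T) T) (a : ℝ) :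
    flowLabel Z t (Z t a) = a :=
  Function.leftInverse_invFun (h.strictMono_label hr.smooth ht).injective a

theorem flowLabel_of_le (h : IsFlow r T Z) (hr : IsDensity r R A) (ht : t ∈ Ioo (-T) T) {z : ℝ}
    (hz : z ≤ 1 / 2) : flowLabel Z t z = z := by
  have := h.flowLabel_flow hr ht z
  rwa [h.eq_self hr ht hz] at this

/-- Implicit function theorem for `Z t a = z`: the label derivative of `Z` is an exponential, hence
invertible. The implicit function agrees with `flowLabel` because `Z t` is injective. -/
theorem contDiffAt_flowLabel (h : IsFlow r T Z) (hr : IsDensity r R A) (ht : t ∈ Ioo (-T) T)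
    (z : ℝ) :
    ContDiffAt ℝ ((⊤ : ℕ∞) : WithTop ℕ∞) (Function.uncurry (flowLabel Z)) (t, z) := by
  set a := flowLabel Z t z with ha
  set f : (ℝ × ℝ) × ℝ → ℝ := fun v => Z v.1.1 v.2 - v.1.2 with hf
  set u : (ℝ × ℝ) × ℝ := ((t, z), a) with hu
  have hfu : f u = 0 := by simp [hf, hu, ha, h.flow_flowLabel hr ht z]
  have cdf : ContDiffAt ℝ ((⊤ : ℕ∞) : WithTop ℕ∞) f u := by
    have h1 : ContDiffAt ℝ ((⊤ : ℕ∞) : WithTop ℕ∞)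
        (fun v : (ℝ × ℝ) × ℝ => Function.uncurry Z (v.1.1, v.2)) u :=
      ContDiffAt.comp (f := fun v : (ℝ × ℝ) × ℝ => (v.1.1, v.2)) (g := Function.uncurry Z) u
        (h.contDiffAt hr.smooth ht a).1 (by fun_prop)
    exact h1.sub (by fun_prop)
  have hne : ((⊤ : ℕ∞) : WithTop ℕ∞) ≠ 0 := by simp
  have hder : fderiv ℝ f u ∘L .inr ℝ (ℝ × ℝ) ℝ =
      ContinuousLinearMap.toSpanSingleton ℝ (Real.exp (logStretch r Z t a)) := by
    ext
    have hg : HasDerivAt (fun b : ℝ => (((t, z), b) : (ℝ × ℝ) × ℝ)) ((0 : ℝ × ℝ), (1 : ℝ)) a :=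
      HasDerivAt.prodMk (hasDerivAt_const a (t, z)) (hasDerivAt_id a)
    have h3 := HasFDerivAt.comp_hasDerivAt a (cdf.differentiableAt hne).hasFDerivAt hg
    have h4 := ((h.hasDerivAt hr.smooth ht a).2.2.1).sub_const z
    simpa using! h3.unique h4
  have hinv : (fderiv ℝ f u ∘L .inr ℝ (ℝ × ℝ) ℝ).IsInvertible := by
    rw [hder]
    refine ⟨ContinuousLinearEquiv.unitsEquivAut ℝ (Units.mk0 _ (Real.exp_pos (logStretch r Z t a)).ne'), ?_⟩
    ext; simp
  have hψ := cdf.contDiffAt_implicitFunction hne hinv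
  refine hψ.congr_of_eventuallyEq ?_
  have hT : ∀ᶠ p : ℝ × ℝ in 𝓝 (t, z), p.1 ∈ Ioo (-T) T :=
    continuous_fst.continuousAt.eventually (isOpen_Ioo.mem_nhds ht)
  filter_upwards [hT, cdf.eventually_apply_implicitFunction hne hinv] with p hp hpe
  rw [hfu] at hpe
  have hpe' : Z p.1 (cdf.implicitFunction hne hinv p) = p.2 := sub_eq_zero.1 hpe
  change flowLabel Z p.1 p.2 = _
  rw [← hpe', h.flowLabel_flow hr hp]

theorem hasDerivAt_flowLabel (h : IsFlow r T Z) (hr : IsDensity r R A) (ht : t ∈ Ioo (-T) T)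
    (z : ℝ) :
    HasDerivAt (flowLabel Z t) (Real.exp (logStretch r Z t (flowLabel Z t z)))⁻¹ z := by
  refine HasDerivAt.of_local_left_inverse ?_ (h.hasDerivAt hr.smooth ht _).2.2.1
    (Real.exp_pos _).ne' (Eventually.of_forall fun y => h.flow_flowLabel hr ht y)
  exact ContinuousAt.comp (f := fun b : ℝ => (t, b)) (g := Function.uncurry (flowLabel Z))
      (h.contDiffAt_flowLabel hr ht z).continuousAt (by fun_prop)

theorem hasDerivAt_flowLabel_time (h : IsFlow r T Z) (hr : IsDensity r R A)
    (ht : t ∈ Ioo (-T) T) (z : ℝ) :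
    HasDerivAt (fun s => flowLabel Z s z) (-flowSpeed r Z t (flowLabel Z t z) *
      (Real.exp (logStretch r Z t (flowLabel Z t z)))⁻¹) t := by
  have hd : DifferentiableAt ℝ (fun s => flowLabel Z s z) t := by
    have : DifferentiableAt ℝ (fun s : ℝ => (s, z)) t := by fun_prop
    exact DifferentiableAt.comp (g := Function.uncurry (flowLabel Z)) t
      ((h.contDiffAt_flowLabel hr ht z).differentiableAt (by simp)) this
  have hD := h.hasDerivAt hr.smooth ht (flowLabel Z t z)
  have h1 := hasDerivAt_along (f := Z) (y := fun s => flowLabel Z s z)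
    ((h.contDiffAt hr.smooth ht _).1.differentiableAt (by simp))
    hD.2.2.2.1 hD.2.2.1 hd.hasDerivAt
  have h2 : HasDerivAt (fun s => Z s (flowLabel Z s z)) 0 t := by
    refine (hasDerivAt_const t z).congr_of_eventuallyEq ?_
    filter_upwards [isOpen_Ioo.mem_nhds ht] with s hs
    exact h.flow_flowLabel hr hs z
  have h3 := h1.unique h2
  convert! hd.hasDerivAt using 1
  have := Real.exp_pos (logStretch r Z t (flowLabel Z t z))
  field_simp
  linarith

theorem flowLabel_zero_time (h : IsFlow r T Z) (hT : 0 < T) (hr : IsDensity r R A) (z : ℝ) :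
    flowLabel Z 0 z = z := by
  have h0 : (0 : ℝ) ∈ Ioo (-T) T := ⟨by linarith, hT⟩
  have : Z 0 z = z := by rw [h.eq 0 h0]; simp [nextFlow, logStretch]
  have h1 := h.flowLabel_flow hr h0 z
  rwa [this] at h1

section eulerian

variable {g : ℝ → ℝ → ℝ} {x : ℝ}

theorem eulerian_of_pos (hx : 0 < x) :
    eulerian Z g t x = g t (flowLabel Z t (-Real.log x)) := if_pos hx

/-- A particle with density has its label in `[1/2, A]`, so its position `z` lies between `1/2` and
`Z t A`, and the latter is bounded on compact time intervals. -/
theorem exists_support_bound (h : IsFlow r T Z) (hr : IsDensity r R A)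
    (hg : ∀ t a, r a = 0 → g t a = 0) {s : ℝ} (hs : s < T) :
    ∃ δ > 0, ∀ t ∈ Icc (-s) s, ∀ x, eulerian Z g t x ≠ 0 → x ∈ Icc δ (Real.exp (-(1 / 2))) := by
  have hsub : Icc (-s) s ⊆ Ioo (-T) T := fun t ht => ⟨by linarith [ht.1], by linarith [ht.2]⟩
  have hc : ContinuousOn (fun t => Z t A) (Icc (-s) s) := fun t ht =>
    (h.hasDerivAt hr.smooth (hsub ht) A).2.2.2.1.continuousAt.continuousWithinAt
  obtain ⟨M, hM⟩ := isCompact_Icc.bddAbove_image hc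
  refine ⟨Real.exp (-M), Real.exp_pos _, fun t ht x hx => ?_⟩
  have hx0 : 0 < x := by
    by_contra hx0
    exact hx (if_neg hx0)
  rw [eulerian_of_pos hx0] at hx
  have hra : r (flowLabel Z t (-Real.log x)) ≠ 0 := fun h0 => hx (hg _ _ h0)
  have hmem := hr.mem_of_ne_zero hra
  have hmono := (h.strictMono_label hr.smooth (hsub ht)).monotone
  have h1 := hmono hmem.1
  have h2 := hmono hmem.2
  rw [h.flow_flowLabel hr (hsub ht)] at h1 h2
  rw [h.eq_self hr (hsub ht) le_rfl] at h1
  have h3 : Z t A ≤ M := hM ⟨t, ht, rfl⟩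
  rw [← Real.exp_log hx0]
  exact ⟨Real.exp_le_exp.2 (by linarith), Real.exp_le_exp.2 (by linarith)⟩

theorem eulerian_contDiffAt (h : IsFlow r T Z) (hr : IsDensity r R A)
    (hg : ∀ t a, r a = 0 → g t a = 0)
    (hgs : ∀ t ∈ Ioo (-T) T, ∀ a,
      ContDiffAt ℝ ((⊤ : ℕ∞) : WithTop ℕ∞) (Function.uncurry g) (t, a))
    (ht : t ∈ Ioo (-T) T) (x : ℝ) :
    ContDiffAt ℝ ((⊤ : ℕ∞) : WithTop ℕ∞) (Function.uncurry (eulerian Z g)) (t, x) := by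
  rcases lt_or_ge 0 x with hx | hx
  · have hlog : ContDiffAt ℝ ((⊤ : ℕ∞) : WithTop ℕ∞)
        (fun p : ℝ × ℝ => (p.1, -Real.log p.2)) (t, x) :=
      contDiffAt_fst.prodMk ((contDiffAt_snd.log hx.ne').neg)
    have h1 : ContDiffAt ℝ ((⊤ : ℕ∞) : WithTop ℕ∞)
        (fun p : ℝ × ℝ => flowLabel Z p.1 (-Real.log p.2)) (t, x) :=
      ContDiffAt.comp (f := fun p : ℝ × ℝ => (p.1, -Real.log p.2))
        (g := Function.uncurry (flowLabel Z)) (t, x)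
        (h.contDiffAt_flowLabel hr ht _) hlog
    have h2 : ContDiffAt ℝ ((⊤ : ℕ∞) : WithTop ℕ∞)
        (fun p : ℝ × ℝ => g p.1 (flowLabel Z p.1 (-Real.log p.2))) (t, x) :=
      ContDiffAt.comp (f := fun p : ℝ × ℝ => (p.1, flowLabel Z p.1 (-Real.log p.2)))
        (g := Function.uncurry g) (t, x) (hgs t ht _) (contDiffAt_fst.prodMk h1)
    refine h2.congr_of_eventuallyEq ?_
    have : ∀ᶠ p : ℝ × ℝ in 𝓝 (t, x), 0 < p.2 :=
      continuous_snd.continuousAt.eventually (lt_mem_nhds hx)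
    exact this.mono fun p hp => eulerian_of_pos hp
  -- For `x ≤ 0` the function vanishes near `(t, x)`, since the supports stay to the right of some
  -- `δ > 0`.
  · obtain ⟨s, hts, hsT⟩ := exists_between (abs_lt.2 ht)
    obtain ⟨δ, hδ, hsupp⟩ := h.exists_support_bound hr hg hsT
    refine (contDiffAt_const (c := (0 : ℝ))).congr_of_eventuallyEq ?_
    have e1 : ∀ᶠ p : ℝ × ℝ in 𝓝 (t, x), p.2 < δ :=
      continuous_snd.continuousAt.eventually (gt_mem_nhds (hx.trans_lt hδ))
    have e2 : ∀ᶠ p : ℝ × ℝ in 𝓝 (t, x), |p.1| < s :=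
      (continuous_fst.abs).continuousAt.eventually (gt_mem_nhds hts)
    filter_upwards [e1, e2] with p hp1 hp2
    by_contra hne
    have := (hsupp p.1 (abs_le.1 hp2.le) p.2 hne).1
    linarith

theorem hasDerivAt_log_neg (hx : 0 < x) : HasDerivAt (fun y => -Real.log y) (-x⁻¹) x :=
  (Real.hasDerivAt_log hx.ne').neg

theorem hasDerivAt_eulerian (h : IsFlow r T Z) (hr : IsDensity r R A) (ht : t ∈ Ioo (-T) T)
    (hx : 0 < x) {e : ℝ} (he : HasDerivAt (g t) e (flowLabel Z t (-Real.log x))) :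
    HasDerivAt (eulerian Z g t)
      (e * ((Real.exp (logStretch r Z t (flowLabel Z t (-Real.log x))))⁻¹ * -x⁻¹)) x := by
  have h1 := (h.hasDerivAt_flowLabel hr ht (-Real.log x)).comp x (hasDerivAt_log_neg hx)
  have h2 := he.comp x (h₂ := g t) (h := fun y => flowLabel Z t (-Real.log y)) h1
  exact h2.congr_of_eventuallyEq ((lt_mem_nhds hx).mono fun y hy => eulerian_of_pos hy)

theorem hasDerivAt_eulerian_time (h : IsFlow r T Z) (hr : IsDensity r R A)
    (ht : t ∈ Ioo (-T) T) (hx : 0 < x) {d e : ℝ}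
    (hg : DifferentiableAt ℝ (Function.uncurry g) (t, flowLabel Z t (-Real.log x)))
    (hd : HasDerivAt (fun s => g s (flowLabel Z t (-Real.log x))) d t)
    (he : HasDerivAt (g t) e (flowLabel Z t (-Real.log x))) :
    HasDerivAt (fun s => eulerian Z g s x)
      (d + e * (-flowSpeed r Z t (flowLabel Z t (-Real.log x)) *
        (Real.exp (logStretch r Z t (flowLabel Z t (-Real.log x))))⁻¹)) t := by
  simp only [eulerian_of_pos hx]
  exact hasDerivAt_along (y := fun s => flowLabel Z s (-Real.log x)) hg hd he
    (h.hasDerivAt_flowLabel_time hr ht _)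

/-- In the label variable `ω dy / y` is, up to sign, the differential of `flowSpeed`, which vanishes
at label `0`, that is at `y = 1`. -/
theorem velocity_eq (h : IsFlow r T Z) (hr : IsDensity r R A) (ht : t ∈ Ioo (-T) T)
    (hx : 0 < x) :
    velocity (eulerian Z (labelVorticity r Z) t) x =
      -x * flowSpeed r Z t (flowLabel Z t (-Real.log x)) := by
  have hpos : ∀ y ∈ uIcc x 1, 0 < y := fun y hy => by
    rcases mem_uIcc.1 hy with h | h <;> linarith [h.1]
  have hder : ∀ y ∈ uIcc x 1, HasDerivAt (fun y => -flowSpeed r Z t (flowLabel Z t (-Real.log y)))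
      (eulerian Z (labelVorticity r Z) t y / y) y := by
    intro y hy
    have hy0 := hpos y hy
    have h1 := h.hasDerivAt_eulerian (g := flowSpeed r Z) hr ht hy0
      (h.hasDerivAt hr.smooth ht _).2.2.2.2
    have h2 := (h1.congr_of_eventuallyEq (f₁ := fun y => flowSpeed r Z t
      (flowLabel Z t (-Real.log y)))
      ((lt_mem_nhds hy0).mono fun y hy => (eulerian_of_pos hy).symm)).neg
    convert! h2 using 1
    rw [eulerian_of_pos hy0]
    have := Real.exp_pos (logStretch r Z t (flowLabel Z t (-Real.log y)))
    field_simp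
  have hvz : ∀ t a, r a = 0 → labelVorticity r Z t a = 0 := fun t a h0 => by
    simp [labelVorticity, h0]
  have hint : IntervalIntegrable (fun y => eulerian Z (labelVorticity r Z) t y / y)
      volume x 1 := by
    refine ContinuousOn.intervalIntegrable fun y hy => ContinuousAt.continuousWithinAt ?_
    refine ContinuousAt.div ?_ continuousAt_id (hpos y hy).ne'
    exact ContinuousAt.comp (f := fun b : ℝ => (t, b))
      (g := Function.uncurry (eulerian Z (labelVorticity r Z)))
      (h.eulerian_contDiffAt hr hvz (fun t ht a => (h.contDiffAt hr.smooth ht a).2.1) ht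
        y).continuousAt (by fun_prop)
  rw [velocity, intervalIntegral.integral_eq_sub_of_hasDerivAt hder hint]
  rw [Real.log_one, neg_zero, h.flowLabel_of_le hr ht (by norm_num)]
  simp [flowSpeed]

end eulerian

end IsFlow

/-! ### Smooth families with controlled supports lie in every `C([0,T), K^n)`. -/

/-- A jointly smooth family of functions on `(-T, T)` whose supports stay, locally uniformly in
time, in compact subsets of `(0, 1)`. -/
structure IsSmoothFamily (T : ℝ) (f : ℝ → ℝ → ℝ) : Prop where
  contDiffAt : ∀ t ∈ Ioo (-T) T, ∀ x,
    ContDiffAt ℝ ((⊤ : ℕ∞) : WithTop ℕ∞) (Function.uncurry f) (t, x)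
  exists_support : ∀ s < T, ∃ δ > 0, ∃ x₁ < 1, ∀ t ∈ Icc (-s) s, ∀ x, f t x ≠ 0 → x ∈ Icc δ x₁

namespace IsSmoothFamily

variable {T t : ℝ} {f : ℝ → ℝ → ℝ}

theorem contDiff (h : IsSmoothFamily T f) (ht : t ∈ Ioo (-T) T) :
    ContDiff ℝ ((⊤ : ℕ∞) : WithTop ℕ∞) (f t) :=
  contDiff_iff_contDiffAt.2 fun x =>
    ContDiffAt.comp (f := fun b : ℝ => (t, b)) (g := Function.uncurry f) x
      (h.contDiffAt t ht x) (by fun_prop)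

theorem contDiffAt_iteratedDeriv (h : IsSmoothFamily T f) (k : ℕ) (ht : t ∈ Ioo (-T) T) (x : ℝ) :
    ContDiffAt ℝ ((⊤ : ℕ∞) : WithTop ℕ∞) (fun p : ℝ × ℝ => iteratedDeriv k (f p.1) p.2)
      (t, x) := by
  induction k generalizing t x with
  | zero => simpa only [iteratedDeriv_zero] using! h.contDiffAt t ht x
  | succ k ih =>
    have h1 : ContDiffAt ℝ ((⊤ : ℕ∞) : WithTop ℕ∞)
        (fun p => fderiv ℝ (fun p : ℝ × ℝ => iteratedDeriv k (f p.1) p.2) p (0, 1)) (t, x) :=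
      ((ih ht x).fderiv_right (m := ((⊤ : ℕ∞) : WithTop ℕ∞)) (by simp)).clm_apply contDiffAt_const
    refine h1.congr_of_eventuallyEq ?_
    have hT : ∀ᶠ p : ℝ × ℝ in 𝓝 (t, x), p.1 ∈ Ioo (-T) T :=
      continuous_fst.continuousAt.eventually (isOpen_Ioo.mem_nhds ht)
    filter_upwards [hT] with p hp
    have hg : HasDerivAt (fun a : ℝ => (p.1, a)) ((0 : ℝ), (1 : ℝ)) p.2 :=
      HasDerivAt.prodMk (hasDerivAt_const p.2 p.1) (hasDerivAt_id p.2)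
    have h3 := HasFDerivAt.comp_hasDerivAt p.2 ((ih hp p.2).differentiableAt (by simp)).hasFDerivAt
      hg
    rw [iteratedDeriv_succ]
    exact h3.deriv

theorem tsupport_subset {s δ x₁ : ℝ} (hs : ∀ x, f s x ≠ 0 → x ∈ Icc δ x₁) :
    tsupport (f s) ⊆ Icc δ x₁ :=
  closure_minimal (fun x hx => hs x hx) isClosed_Icc

theorem iteratedDeriv_eq_zero {g : ℝ → ℝ} {δ x₁ : ℝ} (hs : tsupport g ⊆ Icc δ x₁) (k : ℕ) {x : ℝ}
    (hx : x ∉ Icc δ x₁) : iteratedDeriv k g x = 0 := by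
  have : g =ᶠ[𝓝 x] fun _ => 0 := notMem_tsupport_iff_eventuallyEq.1 fun h => hx (hs h)
  rw [this.iteratedDeriv_eq]
  simp

theorem memK (h : IsSmoothFamily T f) (n : ℕ) (ht : t ∈ Ioo (-T) T) : MemK n (f t) := by
  obtain ⟨δ, hδ, x₁, hx₁, hs⟩ := h.exists_support |t| (abs_lt.2 ht)
  have hsub := tsupport_subset (hs t ⟨neg_abs_le t, le_abs_self t⟩)
  exact ⟨(h.contDiff ht).of_le (by exact_mod_cast le_top),
    HasCompactSupport.of_support_subset_isCompact isCompact_Icc ((subset_tsupport _).trans hsub),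
    fun x hx => ⟨hδ.trans_le (hsub hx).1, (hsub hx).2.trans_lt hx₁⟩⟩

theorem tendsto_cNorm (h : IsSmoothFamily T f) (n : ℕ) {s : ℝ} (hs : s ∈ Ioo (-T) T) :
    Tendsto (fun t => cNorm n (f t - f s)) (𝓝 s) (𝓝 0) := by
  have key : ∀ k : ℕ, Tendsto (fun t => ⨆ x : ℝ, ‖iteratedDeriv k (f t - f s) x‖ₑ) (𝓝 s) (𝓝 0) := by
    intro k
    obtain ⟨s', hs', hsT⟩ := exists_between (abs_lt.2 hs)
    obtain ⟨δ, hδ, x₁, hx₁, hsupp⟩ := h.exists_support s' hsT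
    rw [ENNReal.tendsto_nhds_zero]
    intro ε hε
    obtain ⟨e, he0, heε⟩ : ∃ e : ℝ, 0 < e ∧ ENNReal.ofReal e ≤ ε := by
      rcases eq_or_ne ε ∞ with rfl | hne
      · exact ⟨1, one_pos, le_top⟩
      · exact ⟨ε.toReal, ENNReal.toReal_pos hε.ne' hne, by rw [ENNReal.ofReal_toReal hne]⟩
    -- Joint continuity and compactness of the common support make the convergence uniform in `x`.
    have hunif : ∀ᶠ t in 𝓝 s, ∀ x ∈ Icc δ x₁,
        |iteratedDeriv k (f t) x - iteratedDeriv k (f s) x| < e := by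
      refine isCompact_Icc.eventually_forall_of_forall_eventually fun y _ => ?_
      have c1 : ContinuousAt (fun p : ℝ × ℝ => iteratedDeriv k (f p.1) p.2) (s, y) :=
        (h.contDiffAt_iteratedDeriv k hs y).continuousAt
      have c2 : ContinuousAt (fun p : ℝ × ℝ => iteratedDeriv k (f s) p.2) (s, y) :=
        ContinuousAt.comp (f := fun p : ℝ × ℝ => (s, p.2))
          (g := fun p : ℝ × ℝ => iteratedDeriv k (f p.1) p.2) c1 (by fun_prop)
      exact (c1.sub c2).abs.eventually (gt_mem_nhds (by simpa using he0))
    have habs : ∀ᶠ t : ℝ in 𝓝 s, |t| < s' := continuous_abs.continuousAt.eventually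
      (gt_mem_nhds hs')
    filter_upwards [hunif, habs] with t ht hts
    have hmem : ∀ t : ℝ, |t| < s' → t ∈ Ioo (-T) T := fun t ht => abs_lt.1 (ht.trans hsT)
    have cd : ∀ t : ℝ, |t| < s' → ∀ x, ContDiffAt ℝ k (f t) x := fun t ht x =>
      ((h.contDiff (hmem t ht)).of_le (by exact_mod_cast le_top)).contDiffAt
    refine iSup_le fun x => ?_
    rw [iteratedDeriv_sub (cd t hts x) (cd s hs' x)]
    by_cases hx : x ∈ Icc δ x₁
    · refine le_trans ?_ heε
      rw [← ofReal_norm]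
      exact ENNReal.ofReal_le_ofReal (ht x hx).le
    · rw [iteratedDeriv_eq_zero (tsupport_subset (hsupp t (abs_le.1 hts.le))) k hx,
        iteratedDeriv_eq_zero (tsupport_subset (hsupp s (abs_le.1 hs'.le))) k hx]
      simp
  simpa [cNorm] using tendsto_finsetSum (Finset.range (n + 1)) fun k _ => key k

theorem exists_kNorm_le (h : IsSmoothFamily T f) (n : ℕ) {s : ℝ} (hs : s < T) :
    ∃ M : ℝ≥0∞, M ≠ ∞ ∧ ∀ t ∈ Icc (-s) s, kNorm n (f t) ≤ M := by
  obtain ⟨δ, hδ, x₁, hx₁, hsupp⟩ := h.exists_support s hs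
  have hbd : ∀ k : ℕ, ∃ C : ℝ, ∀ p ∈ Icc (-s) s ×ˢ Icc δ x₁,
      ‖iteratedDeriv k (f p.1) p.2‖ ≤ C := fun k => by
    refine (isCompact_Icc.prod isCompact_Icc).exists_bound_of_continuousOn fun p hp => ?_
    exact (h.contDiffAt_iteratedDeriv k (t := p.1)
      ⟨by linarith [hp.1.1], by linarith [hp.1.2]⟩ p.2).continuousAt.continuousWithinAt
  choose C hC using hbd
  refine ⟨∑ k ∈ Finset.range (n + 1), ENNReal.ofReal (C k) + (ENNReal.ofReal δ)⁻¹, ?_, ?_⟩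
  · refine ENNReal.add_ne_top.2 ⟨ENNReal.sum_ne_top.2 fun _ _ => ENNReal.ofReal_ne_top, ?_⟩
    simpa using hδ
  intro t ht
  have hsub := tsupport_subset (hsupp t ht)
  refine add_le_add (Finset.sum_le_sum fun k _ => iSup_le fun x => ?_) ?_
  · by_cases hx : x ∈ Icc δ x₁
    · rw [← ofReal_norm]
      exact ENNReal.ofReal_le_ofReal (hC k (t, x) ⟨ht, hx⟩)
    · rw [iteratedDeriv_eq_zero hsub k hx]
      simp
  · exact ENNReal.inv_le_inv.2 (le_iInf₂ fun x hx => ENNReal.ofReal_le_ofReal (hsub hx).1)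

theorem continuousInK (h : IsSmoothFamily T f) (n : ℕ) : ContinuousInK n T f := by
  have hmem : ∀ t ∈ Ico 0 T, t ∈ Ioo (-T) T := fun t ht =>
    ⟨by linarith [ht.1, ht.2], ht.2⟩
  refine ⟨fun t ht => h.memK n (hmem t ht), fun s hs =>
    (h.tendsto_cNorm n (hmem s hs)).mono_left nhdsWithin_le_nhds, fun s hs => ?_⟩
  obtain ⟨M, hM, hb⟩ := h.exists_kNorm_le n hs.2
  exact ⟨M, hM, fun t ht => hb t ⟨by linarith [ht.1, hs.1], ht.2⟩⟩

end IsSmoothFamily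

/-! ### The Eulerian functions solve the system. -/

/-- The density at time `0` as a function of `x`. -/
noncomputable def initialDensity (r : ℝ → ℝ) (x : ℝ) : ℝ := if 0 < x then r (-Real.log x) else 0

namespace IsFlow

variable {r : ℝ → ℝ} {R A T : ℝ} {Z : ℝ → ℝ → ℝ}

theorem isSmoothFamily_eulerian (h : IsFlow r T Z) (hr : IsDensity r R A) {g : ℝ → ℝ → ℝ}
    (hg : ∀ t a, r a = 0 → g t a = 0)
    (hgs : ∀ t ∈ Ioo (-T) T, ∀ a,
      ContDiffAt ℝ ((⊤ : ℕ∞) : WithTop ℕ∞) (Function.uncurry g) (t, a)) :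
    IsSmoothFamily T (eulerian Z g) := by
  refine ⟨fun t ht x => h.eulerian_contDiffAt hr hg hgs ht x, fun s hs => ?_⟩
  obtain ⟨δ, hδ, hsupp⟩ := h.exists_support_bound hr hg hs
  exact ⟨δ, hδ, Real.exp (-(1 / 2)), by rw [Real.exp_lt_one_iff]; norm_num, hsupp⟩

theorem isSmoothFamily_vorticity (h : IsFlow r T Z) (hr : IsDensity r R A) :
    IsSmoothFamily T (eulerian Z (labelVorticity r Z)) :=
  h.isSmoothFamily_eulerian hr (fun t a h0 => by simp [labelVorticity, h0])
    fun t ht a => (h.contDiffAt hr.smooth ht a).2.1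

theorem isSmoothFamily_density (h : IsFlow r T Z) (hr : IsDensity r R A) :
    IsSmoothFamily T (eulerian Z fun _ => r) :=
  h.isSmoothFamily_eulerian hr (fun _ _ h0 => h0)
    fun t _ a => (hr.smooth.comp contDiff_snd).contDiffAt (x := (t, a))

theorem isSolution (h : IsFlow r T Z) (hr : IsDensity r R A) (hT : 0 < T) (n : ℕ) :
    IsSolution n (fun _ => 0) (initialDensity r) T (eulerian Z (labelVorticity r Z))
      (eulerian Z fun _ => r) where
  omega_mem := (h.isSmoothFamily_vorticity hr).continuousInK n
  rho_mem := (h.isSmoothFamily_density hr).continuousInK n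
  omega_init := by
    funext x
    simp [eulerian, labelVorticity]
  rho_init := by
    funext x
    simp only [eulerian, initialDensity, h.flowLabel_zero_time hT hr]
  omega_eq := by
    intro t ht x hx
    have htT : t ∈ Ioo (-T) T := ⟨by linarith [ht.1, ht.2], ht.2⟩
    set a := flowLabel Z t (-Real.log x) with ha
    have hdiff := (h.contDiffAt hr.smooth htT a).2.1.differentiableAt (by simp)
    have he : DifferentiableAt ℝ (labelVorticity r Z t) a := by
      have : DifferentiableAt ℝ (fun a : ℝ => (t, a)) a := by fun_prop
      exact DifferentiableAt.comp (g := Function.uncurry (labelVorticity r Z)) a hdiff this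
    have h1 := h.hasDerivAt_eulerian_time hr htT hx.1 hdiff
      (h.hasDerivAt hr.smooth htT a).1 he.hasDerivAt
    have h2 := h.hasDerivAt_eulerian hr htT hx.1 he.hasDerivAt
    -- The motion of the label cancels the transport term, and the remaining source `r a * exp (Z t
    -- a)` equals `ρ / x` because `Z t a = -log x`.
    rw [h.velocity_eq hr htT hx.1, h2.deriv, eulerian_of_pos hx.1, ← ha]
    rw [← ha, h.flow_flowLabel hr htT, Real.exp_neg, Real.exp_log hx.1] at h1
    convert! h1.hasDerivWithinAt using 1
    have := hx.1.ne'
    field_simp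
    ring
  rho_eq := by
    intro t ht x hx
    have htT : t ∈ Ioo (-T) T := ⟨by linarith [ht.1, ht.2], ht.2⟩
    set a := flowLabel Z t (-Real.log x) with ha
    have he : DifferentiableAt ℝ r a := hr.smooth.differentiable (by simp) a
    have hdiff : DifferentiableAt ℝ (Function.uncurry fun _ : ℝ => r) (t, a) :=
      ((hr.smooth.comp contDiff_snd).differentiable (by simp)) (t, a)
    have h1 := h.hasDerivAt_eulerian_time (g := fun _ => r) hr htT hx.1 hdiff
      (hasDerivAt_const t _) he.hasDerivAt
    have h2 := h.hasDerivAt_eulerian (g := fun _ => r) hr htT hx.1 he.hasDerivAt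
    rw [h.velocity_eq hr htT hx.1, h2.deriv, ← ha]
    rw [← ha] at h1
    convert! h1.hasDerivWithinAt using 1
    have := hx.1.ne'
    field_simp
    ring

end IsFlow

/-! ### Blow-up of the three norms. -/

/-- A continuous function exceeding its essential supremum at a point would do so on a nonempty open
set, which has positive measure. -/
theorem enorm_le_supNorm {f : ℝ → ℝ} (hf : ContinuousOn f (Ioo 0 1)) {x : ℝ}
    (hx : x ∈ Ioo (0 : ℝ) 1) : ‖f x‖ₑ ≤ supNorm f := by
  by_contra! hlt
  rw [supNorm, eLpNorm_exponent_top] at hlt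
  have hae : ∀ᵐ y ∂(volume.restrict (Ioo (0 : ℝ) 1)),
      ‖f y‖ₑ ≤ eLpNormEssSup f (volume.restrict (Ioo (0 : ℝ) 1)) := enorm_ae_le_eLpNormEssSup f _
  set c := eLpNormEssSup f (volume.restrict (Ioo (0 : ℝ) 1))
  have hU : IsOpen (Ioo (0 : ℝ) 1 ∩ (fun y => ‖f y‖ₑ) ⁻¹' Ioi c) :=
    (continuous_enorm.comp_continuousOn hf).isOpen_inter_preimage isOpen_Ioo isOpen_Ioi
  have hpos := hU.measure_pos volume ⟨x, hx, hlt⟩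
  rw [ae_restrict_iff' measurableSet_Ioo] at hae
  refine hpos.ne' (measure_mono_null ?_ hae)
  rintro y ⟨hy, hyc⟩ h
  exact (not_le.2 hyc) (h hy)

theorem enorm_div_le_supNorm_deriv {f : ℝ → ℝ} (hf : ContDiff ℝ 1 f) (h0 : f 0 = 0) {x : ℝ}
    (hx : x ∈ Ioo (0 : ℝ) 1) : ‖f x / x‖ₑ ≤ supNorm (deriv f) := by
  have hd : Differentiable ℝ f := hf.differentiable one_ne_zero
  obtain ⟨c, hc, he⟩ := exists_deriv_eq_slope f hx.1 hd.continuous.continuousOn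
    hd.differentiableOn
  rw [h0, sub_zero, sub_zero] at he
  rw [← he]
  exact enorm_le_supNorm (hf.continuous_deriv le_rfl).continuousOn
    ⟨hc.1, hc.2.trans hx.2⟩

theorem lintegral_eq_top_of_integral_unbounded {N : ℝ → ℝ≥0∞} {T : ℝ}
    (h : ∀ M : ℝ, ∃ t ∈ Ico 0 T, ∃ g : ℝ → ℝ, IntervalIntegrable g volume 0 t ∧
      (∀ s ∈ Ioo 0 t, 0 ≤ g s ∧ ENNReal.ofReal (g s) ≤ N s) ∧ M < ∫ s in (0 : ℝ)..t, g s) :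
    ∫⁻ t in Ioo 0 T, N t = ∞ := by
  refine ENNReal.eq_top_of_forall_nnreal_le fun M => ?_
  obtain ⟨t, ht, g, hgi, hg, hM⟩ := h M
  have h1 : ∫⁻ s in Ioo 0 t, ENNReal.ofReal (g s) ≤ ∫⁻ s in Ioo 0 T, N s :=
    (setLIntegral_mono' measurableSet_Ioo fun s hs => (hg s hs).2).trans
      (lintegral_mono_set (Ioo_subset_Ioo_right ht.2.le))
  refine le_trans ?_ h1
  rw [intervalIntegral.integral_of_le ht.1, integral_Ioc_eq_integral_Ioo] at hM
  have hint : IntegrableOn g (Ioo 0 t) :=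
    ((intervalIntegrable_iff_integrableOn_Ioc_of_le ht.1).1 hgi).mono_set Ioo_subset_Ioc_self
  rw [← ofReal_integral_eq_lintegral_ofReal hint
    ((ae_restrict_iff' measurableSet_Ioo).2 (ae_of_all _ fun s hs => (hg s hs).1))]
  rw [ENNReal.le_ofReal_iff_toReal_le ENNReal.coe_ne_top (M.2.trans hM.le)]
  exact hM.le

namespace IsFlow

variable {r : ℝ → ℝ} {R A T t : ℝ} {Z : ℝ → ℝ → ℝ}

/-- `Z t A` is the integral of `exp (logStretch r Z t b)` over labels in `[0, A]`. -/
theorem logStretch_unbounded (h : IsFlow r T Z)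
    (hub : ∀ M : ℝ, ∃ t ∈ Ico 0 T, M < Z t A) (M : ℝ) :
    ∃ t ∈ Ico 0 T, ∃ a, M < logStretch r Z t a := by
  by_contra! hM
  obtain ⟨t, ht, hlt⟩ := hub (Real.exp M * |A - 0|)
  have htT : t ∈ Ioo (-T) T := ⟨by linarith [ht.1, ht.2], ht.2⟩
  refine absurd (le_of_abs_le (abs_intervalIntegral_le (a := 0) (b := A)
    (f := fun b => Real.exp (logStretch r Z t b)) (C := Real.exp M) fun b _ => ?_)) ?_
  · rw [abs_of_pos (Real.exp_pos _)]
    exact Real.exp_le_exp.2 (hM t ht b)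
  · rw [h.eq t htT, nextFlow] at hlt
    exact not_le.2 hlt

/-- The stretch is the time integral of the vorticity over a time less than the finite `T`. -/
theorem labelVorticity_unbounded (h : IsFlow r T Z) (hr : IsDensity r R A)
    (hub : ∀ M : ℝ, ∃ t ∈ Ico 0 T, M < Z t A) (M : ℝ) :
    ∃ t ∈ Ico 0 T, ∃ a, M < labelVorticity r Z t a := by
  by_contra! hM
  obtain ⟨t, ht, a, hlt⟩ := h.logStretch_unbounded hub (|M| * T)
  refine absurd (le_of_abs_le (abs_intervalIntegral_le (a := 0) (b := t)
    (f := fun s => labelVorticity r Z s a) (C := |M|) fun s hs => ?_)) ?_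
  · rw [uIoc_of_le ht.1] at hs
    rw [abs_of_nonneg (labelVorticity_nonneg hr.nonneg hs.1.le a)]
    exact (hM s ⟨hs.1.le, hs.2.trans_lt ht.2⟩ a).trans (le_abs_self M)
  · rw [not_le]
    refine lt_of_le_of_lt ?_ hlt
    rw [sub_zero, abs_of_nonneg ht.1]
    exact mul_le_mul_of_nonneg_left ht.2.le (abs_nonneg M)

theorem exp_neg_flow_mem (h : IsFlow r T Z) (hr : IsDensity r R A) (ht : t ∈ Ioo (-T) T) {a : ℝ}
    (ha : 0 < a) : Real.exp (-Z t a) ∈ Ioo (0 : ℝ) 1 := by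
  refine ⟨Real.exp_pos _, ?_⟩
  have := h.strictMono_label hr.smooth ht ha
  rw [h.apply_zero ht] at this
  rw [Real.exp_lt_one_iff]
  linarith

theorem flowLabel_exp_neg_flow (h : IsFlow r T Z) (hr : IsDensity r R A)
    (ht : t ∈ Ioo (-T) T) (a : ℝ) : flowLabel Z t (-Real.log (Real.exp (-Z t a))) = a := by
  rw [Real.log_exp, neg_neg, h.flowLabel_flow hr ht]

theorem eulerian_exp_neg_flow (h : IsFlow r T Z) (hr : IsDensity r R A)
    (ht : t ∈ Ioo (-T) T) (g : ℝ → ℝ → ℝ) (a : ℝ) :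
    eulerian Z g t (Real.exp (-Z t a)) = g t a := by
  rw [eulerian_of_pos (Real.exp_pos _), h.flowLabel_exp_neg_flow hr ht]

theorem lintegral_supNorm_vorticity (h : IsFlow r T Z) (hr : IsDensity r R A)
    (hub : ∀ M : ℝ, ∃ t ∈ Ico 0 T, M < Z t A) :
    ∫⁻ t in Ioo 0 T, supNorm (eulerian Z (labelVorticity r Z) t) = ∞ := by
  refine lintegral_eq_top_of_integral_unbounded fun M => ?_
  obtain ⟨t, ht, a, hlt⟩ := h.logStretch_unbounded hub M
  have htT : t ∈ Ioo (-T) T := ⟨by linarith [ht.1, ht.2], ht.2⟩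
  refine ⟨t, ht, fun s => labelVorticity r Z s a, h.intervalIntegrable_labelVorticity hr.smooth
    htT a, fun s hs => ⟨labelVorticity_nonneg hr.nonneg hs.1.le a, ?_⟩, hlt⟩
  have hsT : s ∈ Ioo (-T) T := ⟨by linarith [hs.1, hs.2, ht.2], hs.2.trans ht.2⟩
  by_cases hra : r a = 0
  · simp [labelVorticity, hra]
  have ha : 0 < a := one_half_pos.trans_le (hr.mem_of_ne_zero hra).1
  have := enorm_le_supNorm
    ((h.isSmoothFamily_vorticity hr).contDiff hsT).continuous.continuousOn
    (h.exp_neg_flow_mem hr hsT ha)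
  rw [h.eulerian_exp_neg_flow hr hsT] at this
  exact (Real.ofReal_le_enorm _).trans this

/-- Along a path `r a * exp (Z s a)` is `ρ / x`, which the mean value theorem bounds by the sup of
`∂ₓρ`; its time integral is the unbounded vorticity. -/
theorem lintegral_supNorm_deriv_density (h : IsFlow r T Z) (hr : IsDensity r R A)
    (hub : ∀ M : ℝ, ∃ t ∈ Ico 0 T, M < Z t A) :
    ∫⁻ t in Ioo 0 T, supNorm (deriv (eulerian Z (fun _ => r) t)) = ∞ := by
  refine lintegral_eq_top_of_integral_unbounded fun M => ?_
  obtain ⟨t, ht, a, hlt⟩ := h.labelVorticity_unbounded hr hub M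
  have htT : t ∈ Ioo (-T) T := ⟨by linarith [ht.1, ht.2], ht.2⟩
  refine ⟨t, ht, fun s => r a * Real.exp (Z s a),
    (h.intervalIntegrable_exp hr.smooth htT a).const_mul _,
    fun s hs => ⟨mul_nonneg (hr.nonneg a) (Real.exp_pos _).le, ?_⟩, ?_⟩
  · have hsT : s ∈ Ioo (-T) T := ⟨by linarith [hs.1, hs.2, ht.2], hs.2.trans ht.2⟩
    by_cases hra : r a = 0
    · simp [hra]
    have ha : 0 < a := one_half_pos.trans_le (hr.mem_of_ne_zero hra).1
    have := enorm_div_le_supNorm_deriv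
      (((h.isSmoothFamily_density hr).contDiff hsT).of_le (by exact_mod_cast le_top))
      (by simp [eulerian]) (h.exp_neg_flow_mem hr hsT ha)
    rw [h.eulerian_exp_neg_flow hr hsT, Real.exp_neg, div_inv_eq_mul] at this
    exact (Real.ofReal_le_enorm _).trans this
  · rw [intervalIntegral.integral_const_mul]
    exact hlt

theorem hasDerivAt_velocity (h : IsFlow r T Z) (hr : IsDensity r R A)
    (ht : t ∈ Ioo (-T) T) {x : ℝ} (hx : 0 < x) :
    HasDerivAt (velocity (eulerian Z (labelVorticity r Z) t))
      (eulerian Z (labelVorticity r Z) t x - eulerian Z (flowSpeed r Z) t x) x := by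
  have h1 := h.hasDerivAt_eulerian (g := flowSpeed r Z) hr ht hx
    (h.hasDerivAt hr.smooth ht _).2.2.2.2
  have h2 := (hasDerivAt_id x).neg.mul h1
  have h3 := h2.congr_of_eventuallyEq (f₁ := velocity (eulerian Z (labelVorticity r Z) t)) (by
    filter_upwards [lt_mem_nhds hx] with y hy
    simp [h.velocity_eq hr ht hy, eulerian_of_pos hy])
  convert! h3 using 1
  rw [eulerian_of_pos hx, eulerian_of_pos hx]
  have := Real.exp_pos (logStretch r Z t (flowLabel Z t (-Real.log x)))
  simp only [Pi.neg_apply, id]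
  field_simp
  ring

theorem continuousOn_deriv_velocity (h : IsFlow r T Z) (hr : IsDensity r R A)
    (ht : t ∈ Ioo (-T) T) :
    ContinuousOn (deriv (velocity (eulerian Z (labelVorticity r Z) t))) (Ioo 0 1) := by
  have hc : ContinuousOn (fun x => eulerian Z (labelVorticity r Z) t x -
      eulerian Z (flowSpeed r Z) t x) (Ioo 0 1) := by
    refine ((h.isSmoothFamily_vorticity hr).contDiff ht).continuous.continuousOn.sub fun x hx => ?_
    exact (h.hasDerivAt_eulerian (g := flowSpeed r Z) hr ht hx.1
      (h.hasDerivAt hr.smooth ht _).2.2.2.2).continuousAt.continuousWithinAt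
  exact hc.congr fun x hx => (h.hasDerivAt_velocity hr ht hx.1).deriv

theorem flowSpeed_mono (h : IsFlow r T Z) (hr : IsDensity r R A)
    (ht : t ∈ Ioo (-T) T) (ht0 : 0 ≤ t) : Monotone (flowSpeed r Z t) := by
  refine monotone_of_deriv_nonneg
    (fun a => (h.hasDerivAt hr.smooth ht a).2.2.2.2.differentiableAt) fun a => ?_
  rw [(h.hasDerivAt hr.smooth ht a).2.2.2.2.deriv]
  exact mul_nonneg (Real.exp_pos _).le (labelVorticity_nonneg hr.nonneg ht0 a)

/-- At label `b` the derivative of the velocity is `v b - flowSpeed b`. At `A` the vorticity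
vanishes, leaving `-flowSpeed A`. If `flowSpeed A` is below `v a / 2`, so is `flowSpeed a` by
monotonicity, and label `a` itself gives the bound. -/
theorem labelVorticity_le_deriv_velocity (h : IsFlow r T Z) (hr : IsDensity r R A)
    (ht : t ∈ Ioo (-T) T) (ht0 : 0 ≤ t) (a : ℝ) :
    ENNReal.ofReal (labelVorticity r Z t a / 2) ≤
      supNorm (deriv (velocity (eulerian Z (labelVorticity r Z) t))) := by
  by_cases hra : r a = 0
  · simp [labelVorticity, hra]
  have hmem := hr.mem_of_ne_zero hra
  have ha : 0 < a := one_half_pos.trans_le hmem.1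
  have hA := hr.pos
  set u := velocity (eulerian Z (labelVorticity r Z) t) with hu
  have hder : ∀ b, deriv u (Real.exp (-Z t b)) = labelVorticity r Z t b - flowSpeed r Z t b := by
    intro b
    rw [(h.hasDerivAt_velocity hr ht (Real.exp_pos _)).deriv, h.eulerian_exp_neg_flow hr ht,
      h.eulerian_exp_neg_flow hr ht]
  have hcont := h.continuousOn_deriv_velocity hr ht
  have h1 := enorm_le_supNorm hcont (h.exp_neg_flow_mem hr ht ha)
  have h2 := enorm_le_supNorm hcont (h.exp_neg_flow_mem hr ht hA)
  have hA0 : labelVorticity r Z t A = 0 := by simp [labelVorticity, hr.right A le_rfl]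
  have hmono := h.flowSpeed_mono hr ht ht0 hmem.2
  rw [hder] at h1 h2
  rw [hA0, zero_sub, enorm_neg] at h2
  rcases le_total (labelVorticity r Z t a / 2) (flowSpeed r Z t A) with hc | hc
  · exact ((ENNReal.ofReal_le_ofReal hc).trans (Real.ofReal_le_enorm _)).trans h2
  · have : labelVorticity r Z t a / 2 ≤ labelVorticity r Z t a - flowSpeed r Z t a := by linarith
    exact ((ENNReal.ofReal_le_ofReal this).trans (Real.ofReal_le_enorm _)).trans h1

theorem lintegral_supNorm_deriv_velocity (h : IsFlow r T Z) (hr : IsDensity r R A)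
    (hub : ∀ M : ℝ, ∃ t ∈ Ico 0 T, M < Z t A) :
    ∫⁻ t in Ioo 0 T, supNorm (deriv (velocity (eulerian Z (labelVorticity r Z) t))) = ∞ := by
  refine lintegral_eq_top_of_integral_unbounded fun M => ?_
  obtain ⟨t, ht, a, hlt⟩ := h.logStretch_unbounded hub (2 * M)
  have htT : t ∈ Ioo (-T) T := ⟨by linarith [ht.1, ht.2], ht.2⟩
  refine ⟨t, ht, fun s => labelVorticity r Z s a / 2, (h.intervalIntegrable_labelVorticity
    hr.smooth htT a).div_const 2, fun s hs =>
      ⟨div_nonneg (labelVorticity_nonneg hr.nonneg hs.1.le a) zero_le_two, ?_⟩, ?_⟩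
  · exact h.labelVorticity_le_deriv_velocity hr
      ⟨by linarith [hs.1, hs.2, ht.2], hs.2.trans ht.2⟩ hs.1.le a
  · rw [intervalIntegral.integral_div]
    change 2 * M < ∫ s in (0 : ℝ)..t, labelVorticity r Z s a at hlt
    linarith

end IsFlow

/-! ### Uniqueness by an energy estimate. -/

/-- Quantitative membership in `K^1`. -/
structure IsSlice (δ M : ℝ) (f : ℝ → ℝ) : Prop where
  contDiff : ContDiff ℝ 1 f
  left : ∀ x < δ, f x = 0
  right : ∀ x, 1 ≤ x → f x = 0
  le : ∀ x, |f x| ≤ M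
  deriv_le : ∀ x, |deriv f x| ≤ M

theorem ContinuousInK.exists_isSlice {T τ : ℝ} {f : ℝ → ℝ → ℝ} (h : ContinuousInK 1 T f)
    (hτ : τ ∈ Ico 0 T) : ∃ δ > 0, ∃ M : ℝ, ∀ t ∈ Icc 0 τ, IsSlice δ M (f t) := by
  obtain ⟨M, hM, hb⟩ := h.2.2 τ hτ
  have hM0 : 0 ≤ M.toReal := ENNReal.toReal_nonneg
  -- A support point `x` satisfies `x⁻¹ ≤ M`; adding `1` keeps the quotient meaningful when the
  -- bound is `0`.
  refine ⟨1 / (M.toReal + 1), by positivity, M.toReal, fun t ht => ?_⟩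
  obtain ⟨hcd, -, hsub⟩ := h.1 t ⟨ht.1, ht.2.trans_lt hτ.2⟩
  have hk : ∀ k ∈ Finset.range 2, ∀ x, |iteratedDeriv k (f t) x| ≤ M.toReal := by
    intro k hk x
    have h1 : ‖iteratedDeriv k (f t) x‖ₑ ≤ M :=
      calc ‖iteratedDeriv k (f t) x‖ₑ ≤ ⨆ x : ℝ, ‖iteratedDeriv k (f t) x‖ₑ :=
            le_iSup (fun x : ℝ => ‖iteratedDeriv k (f t) x‖ₑ) x
        _ ≤ cNorm 1 (f t) := Finset.single_le_sum
            (f := fun k => ⨆ x : ℝ, ‖iteratedDeriv k (f t) x‖ₑ) (fun _ _ => zero_le) hk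
        _ ≤ kNorm 1 (f t) := le_self_add
        _ ≤ M := hb t ht
    rw [← ofReal_norm] at h1
    exact (ENNReal.ofReal_le_iff_le_toReal hM).1 h1
  have hout : ∀ x, x ∉ tsupport (f t) → f t x = 0 := fun x hx => image_eq_zero_of_notMem_tsupport hx
  refine ⟨by simpa using hcd, fun x hx => hout x fun hxs => ?_,
    fun x hx => hout x fun hxs => absurd (hsub hxs).2 (not_lt.2 hx), fun x => ?_, fun x => ?_⟩
  · have hx0 := (hsub hxs).1
    have h1 : (⨅ x ∈ tsupport (f t), ENNReal.ofReal x)⁻¹ ≤ M := le_add_self.trans (hb t ht)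
    have h2 : (ENNReal.ofReal x)⁻¹ ≤ M :=
      (ENNReal.inv_le_inv.2 (iInf₂_le x hxs)).trans h1
    rw [← ENNReal.ofReal_inv_of_pos hx0, ENNReal.ofReal_le_iff_le_toReal hM] at h2
    rw [lt_div_iff₀ (by positivity)] at hx
    have h3 : x⁻¹ * x = 1 := inv_mul_cancel₀ hx0.ne'
    nlinarith
  · simpa using hk 0 (by simp) x
  · simpa using hk 1 (by simp) x

theorem IsSlice.mono {δ δ' M M' : ℝ} {f : ℝ → ℝ} (h : IsSlice δ M f) (hδ : δ' ≤ δ)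
    (hM : M ≤ M') : IsSlice δ' M' f :=
  ⟨h.contDiff, fun x hx => h.left x (hx.trans_le hδ), h.right, fun x => (h.le x).trans hM,
    fun x => (h.deriv_le x).trans hM⟩

namespace IsSlice

variable {δ M : ℝ} {f g : ℝ → ℝ}

theorem bound_nonneg (h : IsSlice δ M f) : 0 ≤ M := (abs_nonneg _).trans (h.le 0)

theorem sub (h : IsSlice δ M f) (h' : IsSlice δ M g) : IsSlice δ (M + M) (fun x => f x - g x) where
  contDiff := h.contDiff.sub h'.contDiff
  left x hx := by rw [h.left x hx, h'.left x hx, sub_zero]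
  right x hx := by rw [h.right x hx, h'.right x hx, sub_zero]
  le x := (abs_sub _ _).trans (add_le_add (h.le x) (h'.le x))
  deriv_le x := by
    rw [deriv_fun_sub (h.contDiff.differentiable one_ne_zero x)
      (h'.contDiff.differentiable one_ne_zero x)]
    exact (abs_sub _ _).trans (add_le_add (h.deriv_le x) (h'.deriv_le x))

theorem continuous_div (h : IsSlice δ M f) (hδ : 0 < δ) : Continuous fun y => f y / y := by
  refine continuous_iff_continuousAt.2 fun y => ?_
  rcases lt_or_ge y δ with hy | hy
  · refine (continuousAt_const (y := (0 : ℝ))).congr ?_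
    filter_upwards [gt_mem_nhds hy] with z hz
    rw [h.left z hz, zero_div]
  · exact h.contDiff.continuous.continuousAt.div continuousAt_id (hδ.trans_le hy).ne'

theorem abs_div_le (h : IsSlice δ M f) (hδ : 0 < δ) (y : ℝ) : |f y / y| ≤ |f y| / δ := by
  rcases lt_or_ge y δ with hy | hy
  · simp [h.left y hy]
  · rw [abs_div, abs_of_pos (hδ.trans_le hy)]
    gcongr

theorem hasDerivAt_velocity (h : IsSlice δ M f) (hδ : 0 < δ) (x : ℝ) :
    HasDerivAt (velocity f) (f x - ∫ y in x..1, f y / y) x := by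
  have hc := h.continuous_div hδ
  have h1 : HasDerivAt (fun x => ∫ y in x..1, f y / y) (-(f x / x)) x :=
    intervalIntegral.integral_hasDerivAt_left (hc.intervalIntegrable _ _)
      (hc.stronglyMeasurableAtFilter _ _) hc.continuousAt
  have h2 := (hasDerivAt_id x).neg.mul h1
  convert! h2 using 1
  simp only [Pi.neg_apply, id]
  rcases eq_or_ne x 0 with rfl | hx
  · simp [h.left 0 hδ]
  · field_simp
    ring

theorem abs_integral_div_le (h : IsSlice δ M f) (hδ : 0 < δ) {x : ℝ} (hx : x ∈ Icc (0 : ℝ) 1) :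
    |∫ y in x..1, f y / y| ≤ (∫ y in (0 : ℝ)..1, |f y|) / δ := by
  have hc := h.continuous_div hδ
  have hf := h.contDiff.continuous
  have hi : ∀ a b, IntervalIntegrable (fun y => |f y| / δ) volume a b := fun a b =>
    Continuous.intervalIntegrable (by fun_prop) _ _
  calc |∫ y in x..1, f y / y| ≤ ∫ y in x..1, |f y / y| :=
        intervalIntegral.abs_integral_le_integral_abs hx.2
    _ ≤ ∫ y in x..1, |f y| / δ := intervalIntegral.integral_mono_on hx.2
        (hc.abs.intervalIntegrable _ _) (hi _ _) fun y _ => h.abs_div_le hδ y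
    _ ≤ ∫ y in (0 : ℝ)..1, |f y| / δ := by
        rw [← intervalIntegral.integral_add_adjacent_intervals (hi 0 x) (hi x 1)]
        exact le_add_of_nonneg_left (intervalIntegral.integral_nonneg hx.1 fun y _ => by positivity)
    _ = _ := intervalIntegral.integral_div _ _

theorem integral_abs_le (h : IsSlice δ M f) : ∫ y in (0 : ℝ)..1, |f y| ≤ M := by
  have := abs_intervalIntegral_le (a := 0) (b := 1) (f := fun y => |f y|) (C := M)
    fun y _ => by simpa using h.le y
  simpa using (le_abs_self _).trans this

theorem abs_velocity_le (h : IsSlice δ M f) (hδ : 0 < δ) {x : ℝ} (hx : x ∈ Icc (0 : ℝ) 1) :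
    |velocity f x| ≤ (∫ y in (0 : ℝ)..1, |f y|) / δ := by
  rw [velocity, abs_mul, abs_neg, abs_of_nonneg hx.1]
  exact (mul_le_of_le_one_left (abs_nonneg _) hx.2).trans (h.abs_integral_div_le hδ hx)

theorem velocity_sub (h : IsSlice δ M f) (h' : IsSlice δ M g) (hδ : 0 < δ) (x : ℝ) :
    velocity f x - velocity g x = velocity (fun x => f x - g x) x := by
  simp only [velocity, sub_div]
  rw [intervalIntegral.integral_sub ((h.continuous_div hδ).intervalIntegrable _ _)
    ((h'.continuous_div hδ).intervalIntegrable _ _)]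
  ring

end IsSlice

/-- The variance of `|f|` on the unit interval is nonnegative. -/
theorem sq_integral_abs_le {f : ℝ → ℝ} (hf : Continuous f) :
    (∫ y in (0 : ℝ)..1, |f y|) ^ 2 ≤ ∫ y in (0 : ℝ)..1, f y ^ 2 := by
  set m := ∫ y in (0 : ℝ)..1, |f y| with hm
  have h0 : 0 ≤ ∫ y in (0 : ℝ)..1, (|f y| - m) ^ 2 :=
    intervalIntegral.integral_nonneg zero_le_one fun y _ => sq_nonneg _
  have h1 : ∫ y in (0 : ℝ)..1, (|f y| - m) ^ 2
      = (∫ y in (0 : ℝ)..1, f y ^ 2) - 2 * m * m + m ^ 2 := by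
    have : ∀ y, (|f y| - m) ^ 2 = f y ^ 2 - 2 * m * |f y| + m ^ 2 := fun y => by
      rw [sub_sq, sq_abs]; ring
    simp only [this]
    rw [intervalIntegral.integral_add (Continuous.intervalIntegrable (by fun_prop) _ _)
      (Continuous.intervalIntegrable (by fun_prop) _ _), intervalIntegral.integral_sub
      (Continuous.intervalIntegrable (by fun_prop) _ _)
      (Continuous.intervalIntegrable (by fun_prop) _ _), intervalIntegral.integral_const_mul, ← hm]
    simp
  nlinarith

/-- The time derivative of `(ω₁ - ω₂)² + (ρ₁ - ρ₂)²` for two solutions. -/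
noncomputable def energyRate (ω₁ ρ₁ ω₂ ρ₂ : ℝ → ℝ) (x : ℝ) : ℝ :=
  2 * (ω₁ x - ω₂ x) * ((ρ₁ x / x - velocity ω₁ x * deriv ω₁ x) -
    (ρ₂ x / x - velocity ω₂ x * deriv ω₂ x)) +
  2 * (ρ₁ x - ρ₂ x) * (-(velocity ω₁ x * deriv ρ₁ x) - -(velocity ω₂ x * deriv ρ₂ x))

section energy

variable {δ M : ℝ} {ω₁ ρ₁ ω₂ ρ₂ : ℝ → ℝ}

theorem continuous_energyRate (hδ : 0 < δ) (hω₁ : IsSlice δ M ω₁) (hρ₁ : IsSlice δ M ρ₁)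
    (hω₂ : IsSlice δ M ω₂) (hρ₂ : IsSlice δ M ρ₂) : Continuous (energyRate ω₁ ρ₁ ω₂ ρ₂) := by
  have c1 := hω₁.contDiff.continuous
  have c2 := hω₂.contDiff.continuous
  have c3 := hρ₁.contDiff.continuous
  have c4 := hρ₂.contDiff.continuous
  have d1 := hω₁.contDiff.continuous_deriv le_rfl
  have d2 := hω₂.contDiff.continuous_deriv le_rfl
  have d3 := hρ₁.contDiff.continuous_deriv le_rfl
  have d4 := hρ₂.contDiff.continuous_deriv le_rfl
  have e3 := hρ₁.continuous_div hδ
  have e4 := hρ₂.continuous_div hδ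
  have u1 : Continuous (velocity ω₁) :=
    continuous_iff_continuousAt.2 fun x => (hω₁.hasDerivAt_velocity hδ x).continuousAt
  have u2 : Continuous (velocity ω₂) :=
    continuous_iff_continuousAt.2 fun x => (hω₂.hasDerivAt_velocity hδ x).continuousAt
  unfold energyRate
  fun_prop

theorem abs_energyRate_le (hδ : 0 < δ) (hω₁ : IsSlice δ M ω₁) (hρ₁ : IsSlice δ M ρ₁)
    (hω₂ : IsSlice δ M ω₂) (hρ₂ : IsSlice δ M ρ₂) {x : ℝ} (hx : x ∈ Icc (0 : ℝ) 1) :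
    |energyRate ω₁ ρ₁ ω₂ ρ₂ x| ≤
      2 * (M + M) * ((M / δ + M / δ * M) + (M / δ + M / δ * M)) +
        2 * (M + M) * (M / δ * M + M / δ * M) := by
  have hM := hω₁.bound_nonneg
  have hq : ∀ {f}, IsSlice δ M f → |f x / x| ≤ M / δ := fun {f} hf =>
    (hf.abs_div_le hδ x).trans (by gcongr; exact hf.le x)
  have hu : ∀ {f}, IsSlice δ M f → |velocity f x| ≤ M / δ := fun {f} hf =>
    (hf.abs_velocity_le hδ hx).trans (by gcongr; exact hf.integral_abs_le)
  have hud : ∀ {f g : ℝ → ℝ}, IsSlice δ M f → IsSlice δ M g →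
      |velocity f x * deriv g x| ≤ M / δ * M := fun {f g} hf hg => by
    rw [abs_mul]
    exact mul_le_mul (hu hf) (hg.deriv_le x) (abs_nonneg _) (by positivity)
  have hrhs : ∀ {f g : ℝ → ℝ}, IsSlice δ M f → IsSlice δ M g →
      |g x / x - velocity f x * deriv f x| ≤ M / δ + M / δ * M := fun {f g} hf hg =>
    (abs_sub _ _).trans (add_le_add (hq hg) (hud hf hf))
  refine (abs_add_le _ _).trans (add_le_add ?_ ?_)
  · rw [abs_mul, abs_mul, abs_two]
    gcongr
    · exact (hω₁.sub hω₂).le x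
    · exact (abs_sub _ _).trans (add_le_add (hrhs hω₁ hρ₁) (hrhs hω₂ hρ₂))
  · rw [abs_mul, abs_mul, abs_two]
    gcongr
    · exact (hρ₁.sub hρ₂).le x
    · refine (abs_sub _ _).trans (add_le_add ?_ ?_)
      · rw [abs_neg]; exact hud hω₁ hρ₁
      · rw [abs_neg]; exact hud hω₂ hρ₂

/-- With `e = (ω₁ - ω₂)² + (ρ₁ - ρ₂)²` and `u` the velocity of `ω₁`, adding the exact derivative `(u
e)'`, whose integral is `0`, removes every derivative of the differences. The rest is quadratic in
the differences; the velocity difference is bounded by their `L¹` norm, hence by the energy. -/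
theorem integral_energyRate_le (hδ : 0 < δ) (hω₁ : IsSlice δ M ω₁) (hρ₁ : IsSlice δ M ρ₁)
    (hω₂ : IsSlice δ M ω₂) (hρ₂ : IsSlice δ M ρ₂) :
    ∫ x in (0 : ℝ)..1, energyRate ω₁ ρ₁ ω₂ ρ₂ x ≤
      (1 / δ + (M + M / δ) + M + 2 * M * (1 / δ) ^ 2) *
        ∫ x in (0 : ℝ)..1, ((ω₁ x - ω₂ x) ^ 2 + (ρ₁ x - ρ₂ x) ^ 2) := by
  have hM := hω₁.bound_nonneg
  have hw := hω₁.sub hω₂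
  have hq := hρ₁.sub hρ₂
  set w : ℝ → ℝ := fun x => ω₁ x - ω₂ x with hw_def
  set q : ℝ → ℝ := fun x => ρ₁ x - ρ₂ x with hq_def
  set e : ℝ → ℝ := fun x => w x ^ 2 + q x ^ 2 with he
  set m := ∫ y in (0 : ℝ)..1, |w y| with hm
  have hwc := hw.contDiff.continuous
  have hqc := hq.contDiff.continuous
  have hec : Continuous e := by fun_prop
  set u := velocity ω₁ with hu
  set u' : ℝ → ℝ := fun x => ω₁ x - ∫ y in x..1, ω₁ y / y with hu'
  have hud : ∀ x, HasDerivAt u (u' x) x := hω₁.hasDerivAt_velocity hδ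
  have huc : Continuous u := continuous_iff_continuousAt.2 fun x => (hud x).continuousAt
  have hu'c : Continuous u' := by
    have hc := hω₁.continuous_div hδ
    refine hω₁.contDiff.continuous.sub ?_
    have : Continuous fun x => -∫ y in (1 : ℝ)..x, ω₁ y / y :=
      (intervalIntegral.continuous_primitive (fun a b => hc.intervalIntegrable a b) 1).neg
    simpa only [← intervalIntegral.integral_symm] using this
  have hd : ∀ {f : ℝ → ℝ}, IsSlice δ M f → ∀ x, HasDerivAt f (deriv f x) x := fun hf x =>
    (hf.contDiff.differentiable one_ne_zero x).hasDerivAt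
  have c1 := hω₁.contDiff.continuous_deriv le_rfl
  have c2 := hω₂.contDiff.continuous_deriv le_rfl
  have c3 := hρ₁.contDiff.continuous_deriv le_rfl
  have c4 := hρ₂.contDiff.continuous_deriv le_rfl
  set e' : ℝ → ℝ := fun x => 2 * w x * (deriv ω₁ x - deriv ω₂ x) +
    2 * q x * (deriv ρ₁ x - deriv ρ₂ x) with he'
  have hed : ∀ x, HasDerivAt e (e' x) x := fun x => by
    have := (((hd hω₁ x).sub (hd hω₂ x)).pow 2).add (((hd hρ₁ x).sub (hd hρ₂ x)).pow 2)
    convert! this using 1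
    simp [he', hw_def, hq_def]
  have he'c : Continuous e' := by fun_prop
  have hflux : ∫ x in (0 : ℝ)..1, (u' x * e x + u x * e' x) = 0 := by
    rw [intervalIntegral.integral_eq_sub_of_hasDerivAt (fun x _ => (hud x).mul (hed x))
      (Continuous.intervalIntegrable (by fun_prop) _ _)]
    simp [he, hw.right 1 le_rfl, hq.right 1 le_rfl, hw.left 0 hδ, hq.left 0 hδ]
  have hDc := continuous_energyRate hδ hω₁ hρ₁ hω₂ hρ₂
  have hpt : ∀ x ∈ Icc (0 : ℝ) 1, energyRate ω₁ ρ₁ ω₂ ρ₂ x + (u' x * e x + u x * e' x) ≤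
      (1 / δ + (M + M / δ) + M) * e x + 2 * M * (1 / δ) ^ 2 * m ^ 2 := by
    intro x hx
    have hid : energyRate ω₁ ρ₁ ω₂ ρ₂ x + (u' x * e x + u x * e' x) =
        2 * w x * (q x / x) + u' x * e x - 2 * w x * (velocity w x * deriv ω₂ x) -
          2 * q x * (velocity w x * deriv ρ₂ x) := by
      rw [hw_def, ← hω₁.velocity_sub hω₂ hδ x]
      simp only [energyRate, he', hw_def, hq_def, he, hu]
      ring
    have hv : |velocity w x| ≤ m / δ := hw.abs_velocity_le hδ hx
    have hm0 : 0 ≤ m := intervalIntegral.integral_nonneg zero_le_one fun y _ => abs_nonneg _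
    have b1 : 2 * w x * (q x / x) ≤ 1 / δ * e x := by
      have h1 : 2 * w x * (q x / x) ≤ 2 * |w x| * (|q x| / δ) := by
        refine (le_abs_self _).trans ?_
        rw [abs_mul, abs_mul, abs_two]
        gcongr
        exact hq.abs_div_le hδ x
      have h2 : 2 * |w x| * |q x| ≤ w x ^ 2 + q x ^ 2 := by
        rw [← sq_abs (w x), ← sq_abs (q x)]
        exact two_mul_le_add_sq _ _
      calc _ ≤ _ := h1
        _ = 1 / δ * (2 * |w x| * |q x|) := by ring
        _ ≤ _ := by gcongr
    have b2 : u' x * e x ≤ (M + M / δ) * e x := by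
      have he0 : 0 ≤ e x := by positivity
      refine mul_le_mul_of_nonneg_right ?_ he0
      refine (le_abs_self _).trans ((abs_sub _ _).trans (add_le_add (hω₁.le x) ?_))
      refine (hω₁.abs_integral_div_le hδ hx).trans ?_
      gcongr
      exact hω₁.integral_abs_le
    have b3 : ∀ {a d : ℝ}, |d| ≤ M → -(2 * a * (velocity w x * d)) ≤
        M * a ^ 2 + M * (1 / δ) ^ 2 * m ^ 2 := by
      intro a d hdM
      have h1 : -(2 * a * (velocity w x * d)) ≤ 2 * |a| * (m / δ * M) := by
        refine (neg_le_abs _).trans ?_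
        rw [abs_mul, abs_mul, abs_mul, abs_two]
        gcongr
      have h2 := two_mul_le_add_sq |a| (m / δ)
      rw [sq_abs] at h2
      calc _ ≤ _ := h1
        _ = M * (2 * |a| * (m / δ)) := by ring
        _ ≤ M * (a ^ 2 + (m / δ) ^ 2) := by gcongr
        _ = _ := by ring
    have b4 := b3 (a := w x) (hω₂.deriv_le x)
    have b5 := b3 (a := q x) (hρ₂.deriv_le x)
    rw [hid]
    have : e x = w x ^ 2 + q x ^ 2 := rfl
    have : (1 / δ + (M + M / δ) + M) * e x =
      1 / δ * e x + (M + M / δ) * e x + M * w x ^ 2 + M * q x ^ 2 := by rw [this]; ring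
    linarith
  have hmE : m ^ 2 ≤ ∫ x in (0 : ℝ)..1, e x := by
    refine (sq_integral_abs_le hwc).trans ?_
    refine intervalIntegral.integral_mono_on zero_le_one
      (Continuous.intervalIntegrable (by fun_prop) _ _) (hec.intervalIntegrable _ _) fun x _ => ?_
    exact le_add_of_nonneg_right (sq_nonneg _)
  have hmono := intervalIntegral.integral_mono_on (μ := volume) zero_le_one
    (Continuous.intervalIntegrable (by fun_prop) _ _)
    (Continuous.intervalIntegrable (by fun_prop) _ _) hpt
  rw [intervalIntegral.integral_add (hDc.intervalIntegrable _ _)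
    (Continuous.intervalIntegrable (by fun_prop) _ _), hflux, add_zero,
    intervalIntegral.integral_add (Continuous.intervalIntegrable (by fun_prop) _ _)
    (by simp), intervalIntegral.integral_const_mul] at hmono
  have hconst : ∫ _ in (0 : ℝ)..1, 2 * M * (1 / δ) ^ 2 * m ^ 2 = 2 * M * (1 / δ) ^ 2 * m ^ 2 := by
    simp
  rw [hconst] at hmono
  have hMd : 0 ≤ 2 * M * (1 / δ) ^ 2 := by positivity
  calc _ ≤ _ := hmono
    _ ≤ (1 / δ + (M + M / δ) + M) * (∫ x in (0 : ℝ)..1, e x) +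
        2 * M * (1 / δ) ^ 2 * ∫ x in (0 : ℝ)..1, e x := by gcongr
    _ = _ := by ring

end energy

/-- Grönwall for the energy on `[0, t]`, with support and `C^1` bounds common to both solutions. The
energy starts at `0`, so it stays `0`. -/
theorem IsSolution.unique {ω₀ ρ₀ : ℝ → ℝ} {T₁ T₂ t : ℝ} {ω₁ ρ₁ ω₂ ρ₂ : ℝ → ℝ → ℝ}
    (h₁ : IsSolution 1 ω₀ ρ₀ T₁ ω₁ ρ₁) (h₂ : IsSolution 1 ω₀ ρ₀ T₂ ω₂ ρ₂)
    (ht : t ∈ Ico 0 (min T₁ T₂)) : ω₁ t = ω₂ t ∧ ρ₁ t = ρ₂ t := by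
  have ht₁ : t ∈ Ico 0 T₁ := ⟨ht.1, ht.2.trans_le (min_le_left _ _)⟩
  have ht₂ : t ∈ Ico 0 T₂ := ⟨ht.1, ht.2.trans_le (min_le_right _ _)⟩
  obtain ⟨δ, M, hδ, s1, s2, s3, s4⟩ : ∃ δ M : ℝ, 0 < δ ∧ (∀ s ∈ Icc 0 t, IsSlice δ M (ω₁ s)) ∧
      (∀ s ∈ Icc 0 t, IsSlice δ M (ρ₁ s)) ∧ (∀ s ∈ Icc 0 t, IsSlice δ M (ω₂ s)) ∧
      (∀ s ∈ Icc 0 t, IsSlice δ M (ρ₂ s)) := by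
    obtain ⟨δ1, p1, M1, f1⟩ := h₁.omega_mem.exists_isSlice ht₁
    obtain ⟨δ2, p2, M2, f2⟩ := h₁.rho_mem.exists_isSlice ht₁
    obtain ⟨δ3, p3, M3, f3⟩ := h₂.omega_mem.exists_isSlice ht₂
    obtain ⟨δ4, p4, M4, f4⟩ := h₂.rho_mem.exists_isSlice ht₂
    refine ⟨min (min δ1 δ2) (min δ3 δ4), max (max M1 M2) (max M3 M4),
      lt_min (lt_min p1 p2) (lt_min p3 p4), fun s hs => (f1 s hs).mono ?_ ?_,
      fun s hs => (f2 s hs).mono ?_ ?_, fun s hs => (f3 s hs).mono ?_ ?_,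
      fun s hs => (f4 s hs).mono ?_ ?_⟩ <;> simp
  set e : ℝ → ℝ → ℝ := fun s x => (ω₁ s x - ω₂ s x) ^ 2 + (ρ₁ s x - ρ₂ s x) ^ 2 with he
  set E : ℝ → ℝ := fun s => ∫ x in (0 : ℝ)..1, e s x with hE
  have hM : 0 ≤ M := (s1 0 (left_mem_Icc.2 ht.1)).bound_nonneg
  have hec : ∀ s ∈ Icc 0 t, Continuous (e s) := fun s hs => by
    have c1 := (s1 s hs).contDiff.continuous
    have c2 := (s2 s hs).contDiff.continuous
    have c3 := (s3 s hs).contDiff.continuous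
    have c4 := (s4 s hs).contDiff.continuous
    fun_prop
  have hsub₁ : Icc 0 t ⊆ Ico 0 T₁ := fun s hs => ⟨hs.1, hs.2.trans_lt ht₁.2⟩
  have hsub₂ : Icc 0 t ⊆ Ico 0 T₂ := fun s hs => ⟨hs.1, hs.2.trans_lt ht₂.2⟩
  have he1 : ∀ s ∈ Icc 0 t, e s 1 = 0 := fun s hs => by
    simp [he, (s1 s hs).right 1 le_rfl, (s2 s hs).right 1 le_rfl, (s3 s hs).right 1 le_rfl,
      (s4 s hs).right 1 le_rfl]
  -- time derivative of the energy density
  have hed : ∀ s ∈ Icc 0 t, ∀ x ∈ uIoc (0 : ℝ) 1, HasDerivWithinAt (fun s => e s x)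
      (energyRate (ω₁ s) (ρ₁ s) (ω₂ s) (ρ₂ s) x) (Icc 0 t) s := by
    intro s hs x hx
    rw [uIoc_of_le zero_le_one] at hx
    -- The equations hold only on the open interval; at the endpoint `x = 1` all four functions
    -- vanish.
    rcases eq_or_lt_of_le hx.2 with rfl | hx1
    · have h0 : energyRate (ω₁ s) (ρ₁ s) (ω₂ s) (ρ₂ s) 1 = 0 := by
        simp [energyRate, (s1 s hs).right 1 le_rfl, (s2 s hs).right 1 le_rfl,
          (s3 s hs).right 1 le_rfl, (s4 s hs).right 1 le_rfl]
      rw [h0]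
      exact (hasDerivWithinAt_const s (Icc 0 t) (0 : ℝ)).congr he1 (he1 s hs)
    · have d1 := (h₁.omega_eq s (hsub₁ hs) x ⟨hx.1, hx1⟩).mono hsub₁
      have d2 := (h₁.rho_eq s (hsub₁ hs) x ⟨hx.1, hx1⟩).mono hsub₁
      have d3 := (h₂.omega_eq s (hsub₂ hs) x ⟨hx.1, hx1⟩).mono hsub₂
      have d4 := (h₂.rho_eq s (hsub₂ hs) x ⟨hx.1, hx1⟩).mono hsub₂
      convert! ((d1.sub d3).pow 2).add ((d2.sub d4).pow 2) using 1
      simp [energyRate]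
  set B := 2 * (M + M) * ((M / δ + M / δ * M) + (M / δ + M / δ * M)) +
        2 * (M + M) * (M / δ * M + M / δ * M) with hB
  set C := 1 / δ + (M + M / δ) + M + 2 * M * (1 / δ) ^ 2 with hC
  have hEcont : ContinuousOn E (Icc 0 t) := by
    intro s hs
    refine intervalIntegral.continuousWithinAt_of_dominated_interval
      (bound := fun _ => (M + M) ^ 2 + (M + M) ^ 2) ?_ ?_ intervalIntegrable_const ?_
    · filter_upwards [self_mem_nhdsWithin] with s hs
      exact (hec s hs).aestronglyMeasurable
    · filter_upwards [self_mem_nhdsWithin] with s hs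
      refine ae_of_all _ fun x _ => ?_
      have b1 := ((s1 s hs).sub (s3 s hs)).le x
      have b2 := ((s2 s hs).sub (s4 s hs)).le x
      rw [Real.norm_of_nonneg (by positivity)]
      simp only [he]
      rw [← sq_abs (ω₁ s x - ω₂ s x), ← sq_abs (ρ₁ s x - ρ₂ s x)]
      gcongr
    · exact ae_of_all _ fun x hx => (hed s hs x hx).continuousWithinAt
  have hEderiv : ∀ s ∈ Ioo 0 t, HasDerivAt E
      (∫ x in (0 : ℝ)..1, energyRate (ω₁ s) (ρ₁ s) (ω₂ s) (ρ₂ s) x) s := by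
    intro s hs
    have hI : Ioo 0 t ⊆ Icc 0 t := Ioo_subset_Icc_self
    refine (intervalIntegral.hasDerivAt_integral_of_dominated_loc_of_deriv_le
      (F := e) (F' := fun s x => energyRate (ω₁ s) (ρ₁ s) (ω₂ s) (ρ₂ s) x) (bound := fun _ => B)
      (isOpen_Ioo.mem_nhds hs) ?_ ?_ ?_ ?_ intervalIntegrable_const ?_).2
    · filter_upwards [isOpen_Ioo.mem_nhds hs] with s hs
      exact (hec s (hI hs)).aestronglyMeasurable
    · exact (hec s (hI hs)).intervalIntegrable _ _
    · exact (continuous_energyRate hδ (s1 s (hI hs)) (s2 s (hI hs)) (s3 s (hI hs))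
        (s4 s (hI hs))).aestronglyMeasurable
    · refine ae_of_all _ fun x hx s hs => ?_
      rw [uIoc_of_le zero_le_one] at hx
      exact abs_energyRate_le hδ (s1 s (hI hs)) (s2 s (hI hs)) (s3 s (hI hs))
        (s4 s (hI hs)) ⟨hx.1.le, hx.2⟩
    · exact ae_of_all _ fun x hx s hs => (hed s (hI hs) x hx).hasDerivAt (Icc_mem_nhds hs.1 hs.2)
  have hanti : AntitoneOn (fun s => E s * Real.exp (-(C * s))) (Icc 0 t) := by
    have hd : ∀ s ∈ Ioo 0 t, HasDerivAt (fun s => E s * Real.exp (-(C * s)))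
        ((∫ x in (0 : ℝ)..1, energyRate (ω₁ s) (ρ₁ s) (ω₂ s) (ρ₂ s) x) * Real.exp (-(C * s)) +
          E s * (Real.exp (-(C * s)) * -(C * 1))) s := fun s hs =>
      (hEderiv s hs).mul (((hasDerivAt_id s).const_mul C).neg.exp)
    refine antitoneOn_of_deriv_nonpos (convex_Icc 0 t) (hEcont.mul (by fun_prop)) ?_ ?_
    · rw [interior_Icc]
      exact fun s hs => (hd s hs).differentiableAt.differentiableWithinAt
    · rw [interior_Icc]
      intro s hs
      rw [(hd s hs).deriv]
      have hsI := Ioo_subset_Icc_self hs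
      have hle := integral_energyRate_le hδ (s1 s hsI) (s2 s hsI) (s3 s hsI) (s4 s hsI)
      have hp := Real.exp_pos (-(C * s))
      change _ ≤ C * E s at hle
      nlinarith
  have hE0 : E 0 = 0 := by
    simp [hE, he, h₁.omega_init, h₁.rho_init, h₂.omega_init, h₂.rho_init]
  have htI : t ∈ Icc 0 t := right_mem_Icc.2 ht.1
  have hEt : E t ≤ 0 := by
    have := hanti (left_mem_Icc.2 ht.1) htI ht.1
    simp only [hE0, zero_mul] at this
    exact nonpos_of_mul_nonpos_left this (Real.exp_pos _)
  have hzero : ∀ x ∈ Icc (0 : ℝ) 1, e t x = 0 := by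
    intro x hx
    by_contra hne
    have hpos : 0 < e t x := lt_of_le_of_ne (by positivity) (Ne.symm hne)
    have := intervalIntegral.integral_pos zero_lt_one (hec t htI).continuousOn
      (fun y _ => by positivity) ⟨x, hx, hpos⟩
    exact not_le.2 this hEt
  have hfin : ∀ x, ω₁ t x = ω₂ t x ∧ ρ₁ t x = ρ₂ t x := by
    intro x
    by_cases hx : x ∈ Icc (0 : ℝ) 1
    · have h0 := hzero x hx
      simp only [he] at h0
      have := (add_eq_zero_iff_of_nonneg (sq_nonneg _) (sq_nonneg _)).1 h0
      exact ⟨sub_eq_zero.1 (pow_eq_zero_iff two_ne_zero |>.1 this.1),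
        sub_eq_zero.1 (pow_eq_zero_iff two_ne_zero |>.1 this.2)⟩
    · have hout : ∀ {f : ℝ → ℝ}, IsSlice δ M f → f x = 0 := by
        intro f hf
        rcases lt_or_ge x δ with hxδ | hxδ
        · exact hf.left x hxδ
        · refine hf.right x ?_
          by_contra hlt
          exact hx ⟨(hδ.trans_le hxδ).le, (not_le.1 hlt).le⟩
      rw [hout (s1 t htI), hout (s2 t htI), hout (s3 t htI), hout (s4 t htI)]
      exact ⟨rfl, rfl⟩
  exact ⟨funext fun x => (hfin x).1, funext fun x => (hfin x).2⟩

/-! ### The data and the conclusion. -/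

theorem exists_isDensity : ∃ r : ℝ → ℝ, IsDensity r 4 (13 / 2) ∧
    ∀ a ∈ Icc (1 : ℝ) 6, r a = 4 := by
  -- Centre `7/2` with radii `5/2` and `3`: equal to `1` on `[1, 6]` and zero outside `(1/2, 13/2)`.
  let β : ContDiffBump (7 / 2 : ℝ) := ⟨5 / 2, 3, by norm_num, by norm_num⟩
  have hβ : ∀ a, 3 ≤ |a - 7 / 2| → β a = 0 := fun a ha =>
    β.zero_of_le_dist (by simpa [β, Real.dist_eq] using ha)
  refine ⟨fun a => 4 * β a, ⟨contDiff_const.mul β.contDiff,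
    fun a => mul_nonneg (by norm_num) β.nonneg, fun a => ?_, fun a ha => ?_, fun a ha => ?_,
    by norm_num⟩, fun a ha => ?_⟩
  · have := β.le_one (x := a)
    linarith
  · rw [hβ a (by rw [abs_of_nonpos] <;> linarith), mul_zero]
  · rw [hβ a (by rw [abs_of_nonneg] <;> linarith), mul_zero]
  · change 4 * β a = 4
    rw [β.one_of_mem_closedBall, mul_one]
    rw [Metric.mem_closedBall, Real.dist_eq, abs_le]
    constructor <;> simp only [β] <;> linarith [ha.1, ha.2]

end SingularBoussinesq

theorem theorem3 :
    ∃ ω₀ ρ₀ : ℝ → ℝ,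
      SingularBoussinesq.MemKInfty ω₀ ∧ SingularBoussinesq.MemKInfty ρ₀ ∧
      (∀ x, 0 ≤ ω₀ x) ∧ (∀ x, 0 ≤ ρ₀ x) ∧
      ∃ T : ℝ, 0 < T ∧ ∃ ω ρ : ℝ → ℝ → ℝ,
        (∀ n : ℕ, 1 ≤ n → SingularBoussinesq.IsSolution n ω₀ ρ₀ T ω ρ) ∧
        (∀ (T' : ℝ) (ω' ρ' : ℝ → ℝ → ℝ),
          SingularBoussinesq.IsSolution 1 ω₀ ρ₀ T' ω' ρ' →
            ∀ t ∈ Ico 0 (min T T'), ω' t = ω t ∧ ρ' t = ρ t) ∧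
        (∫⁻ t in Ioo 0 T, SingularBoussinesq.supNorm (ω t)) = ∞ ∧
        (∫⁻ t in Ioo 0 T, SingularBoussinesq.supNorm (deriv (ρ t))) = ∞ ∧
        (∫⁻ t in Ioo 0 T,
          SingularBoussinesq.supNorm (deriv (SingularBoussinesq.velocity (ω t)))) = ∞ := by
  obtain ⟨r, hr, hr4⟩ := SingularBoussinesq.exists_isDensity
  -- If the iterates were bounded at all times, the limit would be a flow up to time `6`, against
  -- the bound `5` on lifetimes.
  obtain ⟨T, hT, hbd, hub⟩ := hr.exists_lifetime (by
    by_contra! hbd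
    have h := (hr.isFlow_limitFlow (T := 6) fun t _ => hbd t).1.lifetime_le hr.smooth hr.nonneg hr4
    norm_num at h)
  obtain ⟨hflow, hle⟩ := hr.isFlow_limitFlow hbd
  have hub' : ∀ M : ℝ, ∃ t ∈ Ico 0 T, M < SingularBoussinesq.limitFlow r t (13 / 2) := fun M => by
    obtain ⟨t, ht, k, hk⟩ := hub M
    exact ⟨t, ht, hk.trans_le (hle t (by rw [abs_of_nonneg ht.1]; exact ht.2) k _)⟩
  have hsol := fun n => hflow.isSolution hr hT n
  have h0 : (0 : ℝ) ∈ Ico 0 T := ⟨le_rfl, hT⟩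
  refine ⟨fun _ => 0, SingularBoussinesq.initialDensity r, fun n _ => ?_, fun n _ => ?_,
    fun _ => le_rfl, fun x => ?_, T, hT, _, _, fun n _ => hsol n, fun T' ω' ρ' h' t ht => ?_,
    hflow.lintegral_supNorm_vorticity hr hub', hflow.lintegral_supNorm_deriv_density hr hub',
    hflow.lintegral_supNorm_deriv_velocity hr hub'⟩
  · have := (hsol n).omega_mem.1 0 h0
    rwa [(hsol n).omega_init] at this
  · have := (hsol n).rho_mem.1 0 h0
    rwa [(hsol n).rho_init] at this
  · unfold SingularBoussinesq.initialDensity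
    split_ifs
    · exact hr.nonneg _
    · exact le_rfl
  · exact h'.unique (hsol 1) (by rwa [min_comm])
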